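/- Let $i:\mathbb P^1\hookrightarrow T^*\mathbb P^1$ be the zero section over $\mathbb C$, and let $\mathcal D=\mathrm D^b_{\mathbb P^1}(\operatorname{Coh}T^*\mathbb P^1)$ be the category of bounded complexes on $T^*\mathbb P^1$ whose cohomology sheaves are coherent and supported on $\mathbb P^1$. Let $K$ be the doubled Kronecker quiver: two vertices, two arrows $a,b$ from the first to the second, two arrows $a',b'$ back, with the relations $b'a=a'b$ and $ba'=ab'$. Let $\operatorname{mod}^{nil}K$ be its category of finite-dimensional nilpotent complex representations, viewed as a heart of $\mathcal D$ in such a way that the one-dimensional representations $S_0,S_1$ at the two vertices are the objects $i_*\mathcal O_{\mathbb P^1}(-1)$ and $i_*\mathcal O_{\mathbb P^1}(-2)[1]$. For $a_1,a_2,a_3\in\mathbb C\setminus\{0\}$ and $x=\frac{a_1a_3}{a_2^2}$, let $\beta_0(x),\beta_1(x)$ be the roots of $a_1+a_2W+a_3W^2$, and let $$\varpi_0(x)=1,\qquad \varpi_1(x)=\frac{\log\beta_0(x)-\log\beta_1(x)}{2\pi i}$$ for any order of the roots and any choice of the logarithms. The mirror map is $e^{2\pi i\varpi_1(x)}$. Let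 $\sigma=(Z,P)$ be a Bridgeland stability condition on $\mathcal D$ (a central charge $Z:K(\mathcal D)\to\mathbb C$ and a slicing $P$) with heart $P((\theta,\theta+1])=\operatorname{mod}^{nil}K$ for some $\theta\in\mathbb R$, whose central charge is the one of $A_1$ periods: $$Z(i_*\mathcal O_y)=\varpi_0(x)\ \text{ for the points } y\in\mathbb P^1,\qquad Z(i_*\mathcal O_{\mathbb P^1}(-1))=\varpi_1(x).$$ Then $\varpi_1(x)\neq 0$; up to isomorphism, the simple objects of $\operatorname{mod}^{nil}K$ (which correspond to Lagrangian spheres under homological mirror symmetry) are exactly the two non-isomorphic objects $S_0$ and $S_1$; and for every $c\in\mathbb C$ with $e^c=\varpi_1(x)$, let $\sigma'=(Z',P')$ be the stability condition obtained from $\sigma$ by the dilation and rotation $Z'=e^cZ$, $P'(\phi)=P(\phi-\operatorname{Im}c/\pi)$. Then $Z'=\varpi_1(x)Z$, the heart $P'((\theta',\theta'+1])$ for $\theta'=\theta+\operatorname{Im}c/\pi$ is again $\operatorname{mod}^{nil}K$, the sum of the central charges of the simple objects is $$Z'(S_0)+Z'(S_1)=\varpi_1(x),$$ and its exponential is the mirror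 map: $$\exp\bigl(2\pi i\,(Z'(S_0)+Z'(S_1))\bigr)=e^{2\pi i\varpi_1(x)}.$$ -/

import Mathlib

open CategoryTheory CategoryTheory.Limits CategoryTheory.Pretriangulated AlgebraicGeometry

universe v u w

noncomputable section

/-! ### The `A₁` periods -/

/-- The `A₁` period `ϖ₀`, which is constant. -/
def varpiZero (_x : ℂ) : ℂ := 1

/-- `ϖ` is a value at `x` of the (multivalued) `A₁` period
`ϖ₁(x) = (log β₀(x) - log β₁(x)) / (2πi)`, where `x = a₁ a₃ / a₂²` and `β₀, β₁` are the roots of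
the polynomial `a₁ + a₂ W + a₃ W²`; every order of the two roots and every choice of the two
logarithms is allowed. -/
def IsVarpiOne (x ϖ : ℂ) : Prop :=
  ∃ a₁ a₂ a₃ β₀ β₁ l₀ l₁ : ℂ,
    a₁ ≠ 0 ∧ a₂ ≠ 0 ∧ a₃ ≠ 0 ∧ x = a₁ * a₃ / a₂ ^ 2 ∧
    (∀ W : ℂ, a₁ + a₂ * W + a₃ * W ^ 2 = a₃ * (W - β₀) * (W - β₁)) ∧
    Complex.exp l₀ = β₀ ∧ Complex.exp l₁ = β₁ ∧
    ϖ = (l₀ - l₁) / (2 * Real.pi * Complex.I)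

/-- The mirror map, as a function of the value `ϖ = ϖ₁(x)`. -/
def mirrorMap (ϖ : ℂ) : ℂ := Complex.exp (2 * Real.pi * Complex.I * ϖ)

/-! ### Nilpotent representations of the doubled Kronecker quiver -/

/-- The four arrows `a, b : V₀ → V₁` and `a', b' : V₁ → V₀` of a representation of the doubled
Kronecker quiver, as endomorphisms of `V₀ × V₁`. A product of such endomorphisms is the action of
the corresponding path if the arrows are composable and it is zero otherwise. -/
def arrowOperators {V₀ V₁ : Type} [AddCommGroup V₀] [Module ℂ V₀] [AddCommGroup V₁] [Module ℂ V₁]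
    (a b : V₀ →ₗ[ℂ] V₁) (a' b' : V₁ →ₗ[ℂ] V₀) : Set (Module.End ℂ (V₀ × V₁)) :=
  {(LinearMap.inr ℂ V₀ V₁).comp (a.comp (LinearMap.fst ℂ V₀ V₁)),
   (LinearMap.inr ℂ V₀ V₁).comp (b.comp (LinearMap.fst ℂ V₀ V₁)),
   (LinearMap.inl ℂ V₀ V₁).comp (a'.comp (LinearMap.snd ℂ V₀ V₁)),
   (LinearMap.inl ℂ V₀ V₁).comp (b'.comp (LinearMap.snd ℂ V₀ V₁))}

/-- Finite-dimensional nilpotent representations of the doubled Kronecker quiver `K` with the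
commuting relations `b' a = a' b` and `b a' = a b'`. Nilpotent: all sufficiently long paths act
by zero. -/
structure NilRepK where
  V₀ : Type
  V₁ : Type
  [acg₀ : AddCommGroup V₀]
  [mod₀ : Module ℂ V₀]
  [fin₀ : FiniteDimensional ℂ V₀]
  [acg₁ : AddCommGroup V₁]
  [mod₁ : Module ℂ V₁]
  [fin₁ : FiniteDimensional ℂ V₁]
  a : V₀ →ₗ[ℂ] V₁
  b : V₀ →ₗ[ℂ] V₁
  a' : V₁ →ₗ[ℂ] V₀
  b' : V₁ →ₗ[ℂ] V₀
  rel₀ : b'.comp a = a'.comp b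
  rel₁ : b.comp a' = a.comp b'
  nilpotent : ∃ N : ℕ, ∀ l : List (Module.End ℂ (V₀ × V₁)),
    (∀ f ∈ l, f ∈ arrowOperators a b a' b') → l.length = N → l.prod = 0

namespace NilRepK

attribute [instance] acg₀ mod₀ fin₀ acg₁ mod₁ fin₁

/-- Morphisms of representations: linear maps at the vertices that commute with the arrows. -/
@[ext]
structure Hom (M N : NilRepK) where
  f₀ : M.V₀ →ₗ[ℂ] N.V₀
  f₁ : M.V₁ →ₗ[ℂ] N.V₁
  comm_a : f₁.comp M.a = N.a.comp f₀
  comm_b : f₁.comp M.b = N.b.comp f₀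
  comm_a' : f₀.comp M.a' = N.a'.comp f₁
  comm_b' : f₀.comp M.b' = N.b'.comp f₁

/-- The category `mod^nil K`. -/
instance : Category NilRepK where
  Hom := Hom
  id M := ⟨LinearMap.id, LinearMap.id, rfl, rfl, rfl, rfl⟩
  comp {M N L} f g :=
    { f₀ := g.f₀.comp f.f₀
      f₁ := g.f₁.comp f.f₁
      comm_a := by
        rw [LinearMap.comp_assoc, f.comm_a, ← LinearMap.comp_assoc, g.comm_a, LinearMap.comp_assoc]
      comm_b := by
        rw [LinearMap.comp_assoc, f.comm_b, ← LinearMap.comp_assoc, g.comm_b, LinearMap.comp_assoc]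
      comm_a' := by
        rw [LinearMap.comp_assoc, f.comm_a', ← LinearMap.comp_assoc, g.comm_a',
          LinearMap.comp_assoc]
      comm_b' := by
        rw [LinearMap.comp_assoc, f.comm_b', ← LinearMap.comp_assoc, g.comm_b',
          LinearMap.comp_assoc] }

instance (M N : NilRepK) : Zero (M ⟶ N) :=
  ⟨⟨0, 0, by simp, by simp, by simp, by simp⟩⟩

instance : HasZeroMorphisms NilRepK where
  comp_zero _ _ := Hom.ext (LinearMap.zero_comp _) (LinearMap.zero_comp _)
  zero_comp _ _ _ _ := Hom.ext (LinearMap.comp_zero _) (LinearMap.comp_zero _)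

/-- The simple representation with the vector space `ℂ` at the vertex `0`. -/
def simpleZero : NilRepK where
  V₀ := ℂ
  V₁ := PUnit
  a := 0
  b := 0
  a' := 0
  b' := 0
  rel₀ := rfl
  rel₁ := rfl
  nilpotent := ⟨1, fun l hl hlen => by
    obtain ⟨f, rfl⟩ := List.length_eq_one_iff.mp hlen
    have h := hl f (by simp)
    simp only [arrowOperators, LinearMap.zero_comp, LinearMap.comp_zero,
      Set.mem_insert_iff, Set.mem_singleton_iff, or_self] at h
    simp [h]⟩

/-- The simple representation with the vector space `ℂ` at the vertex `1`. -/
def simpleOne : NilRepK where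
  V₀ := PUnit
  V₁ := ℂ
  a := 0
  b := 0
  a' := 0
  b' := 0
  rel₀ := rfl
  rel₁ := rfl
  nilpotent := ⟨1, fun l hl hlen => by
    obtain ⟨f, rfl⟩ := List.length_eq_one_iff.mp hlen
    have h := hl f (by simp)
    simp only [arrowOperators, LinearMap.zero_comp, LinearMap.comp_zero,
      Set.mem_insert_iff, Set.mem_singleton_iff, or_self] at h
    simp [h]⟩

end NilRepK

/-! ### Bridgeland stability conditions -/

section Stability

variable {C : Type u} [Category.{v} C] [HasZeroObject C] [HasShift C ℤ] [Preadditive C]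
  [∀ n : ℤ, (shiftFunctor C n).Additive] [Pretriangulated C] (D : ObjectProperty C)

/-- The relations `[Y] = [X] + [Z]` for distinguished triangles `X ⟶ Y ⟶ Z ⟶ X⟦1⟧` with all three
objects in `D`. -/
def grothendieckRelations : Set (FreeAbelianGroup D.FullSubcategory) :=
  {r | ∃ (X Y Z : D.FullSubcategory) (f : X.obj ⟶ Y.obj) (g : Y.obj ⟶ Z.obj)
      (h : Z.obj ⟶ X.obj⟦(1 : ℤ)⟧), Triangle.mk f g h ∈ distTriang C ∧
      r = FreeAbelianGroup.of Y - FreeAbelianGroup.of X - FreeAbelianGroup.of Z}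

/-- The Grothendieck group `K(D)` of the full triangulated subcategory `D`. -/
def GrothendieckK : Type u :=
  FreeAbelianGroup D.FullSubcategory ⧸ AddSubgroup.closure (grothendieckRelations D)

instance : AddCommGroup (GrothendieckK D) :=
  inferInstanceAs (AddCommGroup
    (FreeAbelianGroup D.FullSubcategory ⧸ AddSubgroup.closure (grothendieckRelations D)))

variable {D} in
/-- The class in `K(D)` of an object of `D`. -/
def classK (E : D.FullSubcategory) : GrothendieckK D :=
  QuotientAddGroup.mk (s := AddSubgroup.closure (grothendieckRelations D)) (FreeAbelianGroup.of E)

/-- `HNFiltration D P l E`: the object `E` of `D` has a filtration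
`0 = E₀ ⟶ E₁ ⟶ ⋯ ⟶ Eₙ = E` in `D`, whose successive cones `Qⱼ` are nonzero objects of `P φⱼ` for
`φ₁ > ⋯ > φₙ`; the list `l` consists of the phases `φₙ, …, φ₁`. -/
inductive HNFiltration (P : ℝ → ObjectProperty C) : List ℝ → C → Prop
  | zero (E : C) : D E → IsZero E → HNFiltration P [] E
  | step (F E Q : C) (f : F ⟶ E) (g : E ⟶ Q) (h : Q ⟶ F⟦(1 : ℤ)⟧) (φ : ℝ) (l : List ℝ) :
      HNFiltration P l F → D E → P φ Q → ¬ IsZero Q → (∀ ψ ∈ l, φ < ψ) →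
      Triangle.mk f g h ∈ distTriang C → HNFiltration P (φ :: l) E

/-- Bridgeland stability conditions on the full triangulated subcategory `D` of `C`: a central
charge `Z` on `K(D)` together with a slicing `P`. -/
structure BridgelandStability where
  Z : GrothendieckK D →+ ℂ
  P : ℝ → ObjectProperty C
  P_le : ∀ φ, P φ ≤ D
  P_iso : ∀ φ (E F : C), (E ≅ F) → P φ E → P φ F
  P_zero : ∀ φ (E : C), IsZero E → P φ E
  P_sum : ∀ φ (E F : C), P φ E → P φ F → P φ (E ⊞ F)
  charge : ∀ φ (E : C) (hE : P φ E), ¬ IsZero E →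
    ∃ m : ℝ, 0 < m ∧ Z (classK ⟨E, P_le φ E hE⟩) = m * Complex.exp (Real.pi * φ * Complex.I)
  P_shift : ∀ φ (E : C), P φ E ↔ P (φ + 1) (E⟦(1 : ℤ)⟧)
  hom_eq_zero : ∀ φ₁ φ₂ (E F : C), φ₂ < φ₁ → P φ₁ E → P φ₂ F → ∀ f : E ⟶ F, f = 0
  exists_HN : ∀ E : C, D E → ∃ l, HNFiltration D P l E

variable {D}

lemma HNFiltration.shift_phase {P : ℝ → ObjectProperty C} (c : ℝ) {l : List ℝ} {E : C}
    (h : HNFiltration D P l E) :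
    HNFiltration D (fun φ => P (φ - c)) (l.map (· + c)) E := by
  induction h with
  | zero E hE h0 => exact .zero E hE h0
  | step F E Q f g h φ l _ hE hQ hQ0 hl hT ih =>
    rw [List.map_cons]
    refine .step F E Q f g h (φ + c) _ ih hE (by simpa using hQ) hQ0 ?_ hT
    intro ψ hψ
    obtain ⟨ψ', h', rfl⟩ := List.mem_map.mp hψ
    have := hl ψ' h'
    linarith

namespace BridgelandStability

/-- The heart `P((θ, θ + 1])` of a stability condition: the objects of `D` all of whose
Harder-Narasimhan phases lie in `(θ, θ + 1]` (in particular, the zero objects). -/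
def heart (σ : BridgelandStability D) (θ : ℝ) : ObjectProperty C :=
  fun E => ∃ l, HNFiltration D σ.P l E ∧ ∀ φ ∈ l, θ < φ ∧ φ ≤ θ + 1

/-- Dilation and rotation of a stability condition by `exp c`, for a complex number `c`: the
central charge is multiplied by `exp c`, the semistable objects stay the same, and all phases are
shifted by `Im c / π`. -/
def dilateRotate (σ : BridgelandStability D) (c : ℂ) : BridgelandStability D where
  Z := (AddMonoidHom.mulLeft (Complex.exp c)).comp σ.Z
  P := fun φ => σ.P (φ - c.im / Real.pi)
  P_le := fun φ => σ.P_le _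
  P_iso := fun φ => σ.P_iso _
  P_zero := fun φ => σ.P_zero _
  P_sum := fun φ => σ.P_sum _
  charge := fun φ E hE h0 => by
    obtain ⟨m, hm, h⟩ := σ.charge _ E hE h0
    refine ⟨Real.exp c.re * m, by positivity, ?_⟩
    simp only [AddMonoidHom.comp_apply, AddMonoidHom.coe_mulLeft, h]
    have hpi : (Real.pi : ℂ) ≠ 0 := by exact_mod_cast Real.pi_ne_zero
    have e : Complex.exp c = Complex.exp c.re * Complex.exp (c.im * Complex.I) := by
      rw [← Complex.exp_add, Complex.re_add_im]
    have e2 : Complex.exp (Real.pi * φ * Complex.I) = Complex.exp (c.im * Complex.I) *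
        Complex.exp (Real.pi * ((φ - c.im / Real.pi : ℝ) : ℂ) * Complex.I) := by
      rw [← Complex.exp_add]
      congr 1
      push_cast
      field_simp
      ring
    rw [e, e2]
    push_cast
    ring
  P_shift := fun φ E => by
    have h := σ.P_shift (φ - c.im / Real.pi) E
    rwa [sub_add_eq_add_sub] at h
  hom_eq_zero := fun φ₁ φ₂ E F h => σ.hom_eq_zero _ _ E F (by linarith)
  exists_HN := fun E hE => by
    obtain ⟨l, hl⟩ := σ.exists_HN E hE
    exact ⟨_, hl.shift_phase _⟩

end BridgelandStability

end Stability

/-! ### The projective line and its cotangent bundle -/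

/-- The coordinate ring `ℂ[z]` of a chart of `ℙ¹`. -/
abbrev ringA : CommRingCat.{0} := CommRingCat.of (Polynomial ℂ)

/-- The coordinate ring `ℂ[z, z⁻¹]` of the overlap of the two charts of `ℙ¹`. -/
abbrev ringG : CommRingCat.{0} := CommRingCat.of (LaurentPolynomial ℂ)

/-- The coordinate ring `ℂ[p][z]` of a chart of `T*ℙ¹`: the outer variable `z` is the coordinate
of the base and the inner variable `p` is the coordinate of the fibre, dual to `dz`. -/
abbrev ringTA : CommRingCat.{0} := CommRingCat.of (Polynomial (Polynomial ℂ))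

/-- The coordinate ring `ℂ[p][z, z⁻¹]` of the overlap of the two charts of `T*ℙ¹`. -/
abbrev ringTG : CommRingCat.{0} := CommRingCat.of (LaurentPolynomial (Polynomial ℂ))

/-- The coordinate change `z ↦ z⁻¹` of `ℙ¹`. -/
def flipP1 : ringG ⟶ ringG :=
  CommRingCat.ofHom (LaurentPolynomial.invert (R := ℂ)).toRingEquiv.toRingHom

/-- The coordinate change `z ↦ z⁻¹`, `p ↦ - z² p` of `T*ℙ¹` (which preserves the form `p dz`), as
a ring homomorphism. -/
def flipTHom : LaurentPolynomial (Polynomial ℂ) →+* LaurentPolynomial (Polynomial ℂ) :=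
  LaurentPolynomial.eval₂
    (Polynomial.eval₂RingHom (LaurentPolynomial.C.comp Polynomial.C)
      (-(LaurentPolynomial.C Polynomial.X * LaurentPolynomial.T 2)))
    (LaurentPolynomial.isUnit_T (R := Polynomial ℂ) (-1)).unit

/-- The coordinate change of `T*ℙ¹`. -/
def flipTP1 : ringTG ⟶ ringTG := CommRingCat.ofHom flipTHom

lemma laurent_unit_zpow {R : Type} [CommRing R] (m n : ℤ) :
    ((LaurentPolynomial.isUnit_T (R := R) m).unit ^ n).val = LaurentPolynomial.T (n * m) := by
  have hu : ((LaurentPolynomial.isUnit_T (R := R) m).unit⁻¹).val = LaurentPolynomial.T (-m) := by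
    refine Units.inv_eq_of_mul_eq_one_right ?_
    rw [IsUnit.unit_spec, ← LaurentPolynomial.T_add]
    simp
  obtain ⟨k, rfl | rfl⟩ := n.eq_nat_or_neg
  · simp [LaurentPolynomial.T_pow]
  · rw [zpow_neg, ← inv_zpow, zpow_natCast, Units.val_pow_eq_pow_val, hu,
      LaurentPolynomial.T_pow]
    simp

lemma flipTHom_T (n : ℤ) : flipTHom (LaurentPolynomial.T n) = LaurentPolynomial.T (-n) := by
  rw [flipTHom, LaurentPolynomial.eval₂_T, laurent_unit_zpow]
  simp

lemma flipTHom_C_C (r : ℂ) : flipTHom (LaurentPolynomial.C (Polynomial.C r)) =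
    LaurentPolynomial.C (Polynomial.C r) := by
  simp [flipTHom]

lemma flipTHom_C_X : flipTHom (LaurentPolynomial.C Polynomial.X) =
    -(LaurentPolynomial.C Polynomial.X * LaurentPolynomial.T 2) := by
  simp [flipTHom]

lemma laurent_ringHom_ext {R S : Type} [CommRing R] [CommRing S]
    {f g : LaurentPolynomial R →+* S}
    (hC : f.comp LaurentPolynomial.C = g.comp LaurentPolynomial.C)
    (hT : ∀ n : ℤ, f (LaurentPolynomial.T n) = g (LaurentPolynomial.T n)) : f = g := by
  refine RingHom.ext fun x => ?_
  induction x using LaurentPolynomial.induction_on' with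
  | add p q hp hq => rw [map_add, map_add, hp, hq]
  | C_mul_T n a =>
    rw [map_mul, map_mul, hT]
    congr 1
    exact congr($hC a)

lemma flipTHom_flipTHom : flipTHom.comp flipTHom = RingHom.id _ := by
  refine laurent_ringHom_ext ?_ fun n => by simp [flipTHom_T]
  apply Polynomial.ringHom_ext
  · intro r
    simp [flipTHom_C_C]
  · simp only [RingHom.comp_apply, flipTHom_C_X, map_neg, map_mul, flipTHom_T, RingHom.id_apply]
    have e : (LaurentPolynomial.T 2 : LaurentPolynomial (Polynomial ℂ)) *
        LaurentPolynomial.T (-2) = 1 := by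
      rw [← LaurentPolynomial.T_add]; simp
    linear_combination (LaurentPolynomial.C (Polynomial.X : Polynomial ℂ)) * e

instance : IsIso flipTP1 :=
  ⟨flipTP1, by rw [flipTP1, ← CommRingCat.ofHom_comp, flipTHom_flipTHom]; rfl,
    by rw [flipTP1, ← CommRingCat.ofHom_comp, flipTHom_flipTHom]; rfl⟩

instance : IsIso flipP1 :=
  inferInstanceAs (IsIso (LaurentPolynomial.invert (R := ℂ)).toRingEquiv.toCommRingCatIso.hom)

/-- The inclusion `ℂ[z] ⟶ ℂ[z, z⁻¹]`. -/
def inclA : ringA ⟶ ringG := CommRingCat.ofHom Polynomial.toLaurent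

/-- The inclusion `ℂ[p][z] ⟶ ℂ[p][z, z⁻¹]`. -/
def inclTA : ringTA ⟶ ringTG := CommRingCat.ofHom Polynomial.toLaurent

instance : IsOpenImmersion (Spec.map inclA) :=
  IsOpenImmersion.of_isLocalization (R := Polynomial ℂ) (S := LaurentPolynomial ℂ) Polynomial.X

instance : IsOpenImmersion (Spec.map inclTA) :=
  IsOpenImmersion.of_isLocalization (R := Polynomial (Polynomial ℂ))
    (S := LaurentPolynomial (Polynomial ℂ)) Polynomial.X

/-- The inclusion of the overlap into the first chart of `ℙ¹`. -/
def overlapZero : Spec ringG ⟶ Spec ringA := Spec.map inclA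

/-- The inclusion of the overlap into the second chart of `ℙ¹`, whose coordinate is `z⁻¹`. -/
def overlapOne : Spec ringG ⟶ Spec ringA := Spec.map (inclA ≫ flipP1)

/-- The inclusion of the overlap into the first chart of `T*ℙ¹`. -/
def overlapTZero : Spec ringTG ⟶ Spec ringTA := Spec.map inclTA

/-- The inclusion of the overlap into the second chart of `T*ℙ¹`, whose coordinates are
`z⁻¹` and `- z² p`. -/
def overlapTOne : Spec ringTG ⟶ Spec ringTA := Spec.map (inclTA ≫ flipTP1)

instance : IsOpenImmersion overlapZero := inferInstanceAs (IsOpenImmersion (Spec.map inclA))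

instance : IsOpenImmersion overlapOne := by
  rw [overlapOne, Spec.map_comp]; infer_instance

instance : IsOpenImmersion overlapTZero := inferInstanceAs (IsOpenImmersion (Spec.map inclTA))

instance : IsOpenImmersion overlapTOne := by
  rw [overlapTOne, Spec.map_comp]; infer_instance

/-- The projective line `ℙ¹` over `ℂ`, glued from two affine lines. -/
def P1 : Scheme.{0} := pushout overlapZero overlapOne

/-- The cotangent bundle `T*ℙ¹` of the projective line, glued from two affine planes. -/
def TP1 : Scheme.{0} := pushout overlapTZero overlapTOne

/-- The first chart of `ℙ¹`. -/
def chartZero : Spec ringA ⟶ P1 := pushout.inl overlapZero overlapOne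

/-- The second chart of `ℙ¹`. -/
def chartOne : Spec ringA ⟶ P1 := pushout.inr overlapZero overlapOne

lemma overlap_condition : overlapZero ≫ chartZero = overlapOne ≫ chartOne := pushout.condition

/-- The zero section `p = 0` in a chart. -/
def zeroSectionRing : ringTA ⟶ ringA :=
  CommRingCat.ofHom (Polynomial.mapRingHom (Polynomial.evalRingHom (0 : ℂ)))

/-- The zero section `p = 0` in the overlap of the charts. -/
def zeroSectionRingG : ringTG ⟶ ringG :=
  CommRingCat.ofHom (LaurentPolynomial.eval₂
    (LaurentPolynomial.C.comp (Polynomial.evalRingHom (0 : ℂ)))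
    (LaurentPolynomial.isUnit_T (R := ℂ) 1).unit)


lemma inclTA_zeroSection : inclTA ≫ zeroSectionRingG = zeroSectionRing ≫ inclA := by
  ext : 1
  apply Polynomial.ringHom_ext
  · intro r
    simp [inclTA, inclA, zeroSectionRing, zeroSectionRingG]
  · simp [inclTA, inclA, zeroSectionRing, zeroSectionRingG]

lemma flip_zeroSection : flipTP1 ≫ zeroSectionRingG = zeroSectionRingG ≫ flipP1 := by
  ext : 1
  refine laurent_ringHom_ext ?_ fun n => ?_
  · apply Polynomial.ringHom_ext
    · intro r
      simp [flipTP1, flipP1, zeroSectionRingG, flipTHom_C_C]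
    · simp [flipTP1, flipP1, zeroSectionRingG, flipTHom_C_X]
  · rw [CommRingCat.comp_apply, CommRingCat.comp_apply]
    change zeroSectionRingG.hom (flipTHom _) =
      LaurentPolynomial.invert (zeroSectionRingG.hom (LaurentPolynomial.T n))
    rw [flipTHom_T]
    have h (m : ℤ) : zeroSectionRingG.hom (LaurentPolynomial.T m) = LaurentPolynomial.T m := by
      rw [zeroSectionRingG, CommRingCat.hom_ofHom, LaurentPolynomial.eval₂_T, laurent_unit_zpow]
      simp
    rw [h, h, LaurentPolynomial.invert_T]

/-- The zero section `i : ℙ¹ ⟶ T*ℙ¹`. -/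
def zeroSection : P1 ⟶ TP1 :=
  pushout.map overlapZero overlapOne overlapTZero overlapTOne
    (Spec.map zeroSectionRing) (Spec.map zeroSectionRing) (Spec.map zeroSectionRingG)
    (by rw [overlapZero, overlapTZero, ← Spec.map_comp, ← Spec.map_comp, inclTA_zeroSection])
    (by
      rw [overlapOne, overlapTOne, ← Spec.map_comp, ← Spec.map_comp, Category.assoc,
        flip_zeroSection, ← Category.assoc, ← Category.assoc, inclTA_zeroSection])

/-- The `ℂ`-points of `ℙ¹`: the point `z = c` of the first chart for `c : ℂ`, and the point `∞`,
which is the origin of the second chart. -/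
def pointP1 : OnePoint ℂ → (Spec (CommRingCat.of ℂ) ⟶ P1)
  | some c => Spec.map (CommRingCat.ofHom (Polynomial.evalRingHom c)) ≫ chartZero
  | none => Spec.map (CommRingCat.ofHom (Polynomial.evalRingHom (0 : ℂ))) ≫ chartOne

/-! ### Sheaves of modules on `ℙ¹` and on `T*ℙ¹` -/

/-- The structure sheaf of a scheme as a sheaf of modules. -/
def structureModule (X : Scheme.{0}) : X.Modules := SheafOfModules.unit X.ringCatSheaf

/-- The morphism `𝒪_Y ⟶ f_* 𝒪_X` that sends a local section `r` to `s · f^♯(r)`, for a global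
section `s` of `𝒪_X`. -/
def mulPullback {X Y : Scheme.{0}} (f : X ⟶ Y) (s : Γ(X, ⊤)) :
    structureModule Y ⟶ (Scheme.Modules.pushforward f).obj (structureModule X) :=
  (SheafOfModules.unitHomEquiv
    (R := Y.ringCatSheaf) ((Scheme.Modules.pushforward f).obj (structureModule X))).symm
    (PresheafOfModules.sectionsMk
      (fun U => X.presheaf.map (homOfLE (le_top : f ⁻¹ᵁ U.unop ≤ ⊤)).op s)
      (fun U V g => by
        change X.presheaf.map ((TopologicalSpace.Opens.map f.base).map g.unop).op
          (X.presheaf.map _ s) = _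
        rw [← CommRingCat.comp_apply, ← Functor.map_comp]
        rfl))

/-- The monomial `z ^ d` as a global function on the overlap of the charts of `ℙ¹`. -/
def overlapMonomial (d : ℤ) : Γ(Spec ringG, ⊤) :=
  (Scheme.ΓSpecIso ringG).inv (LaurentPolynomial.T d)

/-- The Čech differential of the line bundle on `ℙ¹` whose sections over an open set are the
pairs `(s₀, s₁)` of functions on the parts of the open set in the two charts with
`s₀ = z ^ d · s₁` on the overlap; it sends a pair to `s₀ - z ^ d · s₁`. -/
def cechDifferential (d : ℤ) :
    (Scheme.Modules.pushforward chartZero).obj (structureModule (Spec ringA)) ⊞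
      (Scheme.Modules.pushforward chartOne).obj (structureModule (Spec ringA)) ⟶
    (Scheme.Modules.pushforward (overlapZero ≫ chartZero)).obj (structureModule (Spec ringG)) :=
  biprod.desc
    ((Scheme.Modules.pushforward chartZero).map (mulPullback overlapZero 1) ≫
      (Scheme.Modules.pushforwardComp overlapZero chartZero).hom.app _)
    (-((Scheme.Modules.pushforward chartOne).map (mulPullback overlapOne (overlapMonomial d)) ≫
      (Scheme.Modules.pushforwardComp overlapOne chartOne).hom.app _ ≫
      (Scheme.Modules.pushforwardCongr overlap_condition.symm).hom.app _))

/-- The line bundle `𝒪(d)` on `ℙ¹`. -/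
def lineBundle (d : ℤ) : P1.Modules := kernel (cechDifferential d)

/-- The sheaf `i_* 𝒪_{ℙ¹}(d)` on `T*ℙ¹`. -/
def iLineBundle (d : ℤ) : TP1.Modules :=
  (Scheme.Modules.pushforward zeroSection).obj (lineBundle d)

/-- The skyscraper sheaf `i_* 𝒪_y` on `T*ℙ¹`, for a point `y` of `ℙ¹`. -/
def iSkyscraper (y : OnePoint ℂ) : TP1.Modules :=
  (Scheme.Modules.pushforward (pointP1 y ≫ zeroSection)).obj
    (structureModule (Spec (CommRingCat.of ℂ)))

/-- Coherent sheaves on `T*ℙ¹`: the sheaves of modules that are locally of finite presentation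
(`T*ℙ¹` is noetherian). -/
def IsCoherentTP1 (F : TP1.Modules) : Prop :=
  SheafOfModules.IsFinitePresentation (R := TP1.ringCatSheaf) F

/-- The sheaf `F` is supported on the zero section: it vanishes on every open set that is
disjoint from the zero section. -/
def SupportedOnP1 (F : TP1.Modules) : Prop :=
  ∀ U : TP1.Opens, Disjoint (U : Set TP1) (Set.range zeroSection) →
    ∀ s : Γ(F, U), s = 0

/-- The category `D^b_{ℙ¹}(Coh T*ℙ¹)`, as a full subcategory of the derived category of sheaves
of modules: bounded complexes whose cohomology sheaves are coherent and supported on `ℙ¹`. -/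
def dbP1 [HasDerivedCategory.{w} TP1.Modules] : ObjectProperty (DerivedCategory TP1.Modules) :=
  fun E =>
    (∃ N : ℤ, ∀ n : ℤ, N < |n| →
      IsZero ((DerivedCategory.homologyFunctor TP1.Modules n).obj E)) ∧
    ∀ n : ℤ, IsCoherentTP1 ((DerivedCategory.homologyFunctor TP1.Modules n).obj E) ∧
      SupportedOnP1 ((DerivedCategory.homologyFunctor TP1.Modules n).obj E)

end

noncomputable section

/-! ### Central charges of objects of the heart -/

section HeartCharge

variable {C : Type u} [Category.{v} C] [HasZeroObject C] [HasShift C ℤ] [Preadditive C]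
  [∀ n : ℤ, (shiftFunctor C n).Additive] [Pretriangulated C] {D : ObjectProperty C}

/-! Two facts about central charges give the theorem.

First, `[𝒪_y] = [S₀] + [S₁]` in the Grothendieck group for `y` the origin. Thus `Z(S₀) + Z(S₁) = ϖ₀
= 1`, and multiplying the central charge by `e^c = ϖ` turns this sum into `ϖ`. The identity comes
from the short exact sequence `0 ⟶ i_* 𝒪(-2) ⟶ i_* 𝒪(-1) ⟶ i_* 𝒪_y ⟶ 0` on `T*ℙ¹`
(`exists_shortExact_iLineBundle`). Its triangle, rotated once, reads `S₀ ⟶ 𝒪_y ⟶ S₁ ⟶ S₀[1]`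
(`classK_add_of_distTriang_of_iso`).

Second, a nonzero object of `P((θ, θ + 1])` has nonzero charge: the charges of its Harder-Narasimhan
factors lie in one rotated half plane, which is closed under addition and omits `0`
(`charge_ne_zero_of_heart`). For `S₀` this gives `ϖ ≠ 0`. Rotation shifts all phases equally, so the
heart is unchanged once `θ` is shifted too (`dilateRotate_heart_iff`).

For the exact sequence, sections of `𝒪(d)` are pairs `(s₀, s₁)` with `s₀ = z ^ d s₁`. Multiplying
only `s₀` by `z` maps `𝒪(-2)` to `𝒪(-1)`, and the image is the kernel of `s₀ ↦ s₀(0)`. Exactness on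
the left is formal (`nonempty_isLimit_kernelDescMap`) from the sequence `ℂ[z] ⟶ ℂ[z] ⟶ ℂ` on one
chart, and pushforward preserves kernels. Surjectivity is not formal; it is checked locally on the
two charts of `T*ℙ¹` (`epi_pushforward_lineBundleEval`).

The classification of simple representations is independent of this: nilpotency yields a nonzero
vector at one vertex that all arrows kill, and this vector spans a copy of `S₀` or `S₁`
(`exists_homogeneous_killed`). -/

lemma HNFiltration.mem {P : ℝ → ObjectProperty C} {l : List ℝ} {E : C}
    (h : HNFiltration D P l E) : D E := by
  cases h <;> assumption

lemma classK_of_distTriang (X Y Z : D.FullSubcategory) (f : X.obj ⟶ Y.obj) (g : Y.obj ⟶ Z.obj)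
    (h : Z.obj ⟶ X.obj⟦(1 : ℤ)⟧) (hT : Triangle.mk f g h ∈ distTriang C) :
    classK Y = classK X + classK Z := by
  have hmem : FreeAbelianGroup.of Y - FreeAbelianGroup.of X - FreeAbelianGroup.of Z ∈
      AddSubgroup.closure (grothendieckRelations D) :=
    AddSubgroup.subset_closure ⟨X, Y, Z, f, g, h, hT, rfl⟩
  have h0 := (QuotientAddGroup.eq_zero_iff _).mpr hmem
  have h1 : classK Y - classK X - classK Z = 0 := h0
  rw [sub_sub, sub_eq_zero] at h1
  exact h1

/-- For a zero object the triangle `X ⟶ X ⟶ X` is distinguished, so `[X] = [X] + [X]`. -/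
lemma classK_of_isZero (X : D.FullSubcategory) (hX : IsZero X.obj) : classK X = 0 := by
  have h := classK_of_distTriang X X X (𝟙 _) 0 0 (isomorphic_distinguished _
    (contractible_distinguished X.obj) _
      (Triangle.isoMk _ _ (Iso.refl _) (Iso.refl _) (hX.iso (isZero_zero C))
        (hX.eq_of_src _ _) (hX.eq_of_src _ _) (hX.eq_of_src _ _)))
  simpa using h

/-- The half plane `{r · exp (iπφ) | r > 0, 0 < φ ≤ 1}`. -/
def semiclosedUpperHalfPlane : Set ℂ := {z | 0 < z.im ∨ (z.im = 0 ∧ z.re < 0)}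

lemma add_mem_semiclosedUpperHalfPlane {z z' : ℂ} (h : z ∈ semiclosedUpperHalfPlane)
    (h' : z' ∈ semiclosedUpperHalfPlane) : z + z' ∈ semiclosedUpperHalfPlane := by
  simp only [semiclosedUpperHalfPlane, Set.mem_ofPred_eq, Complex.add_im, Complex.add_re] at *
  rcases h with h | ⟨h, h2⟩ <;> rcases h' with h' | ⟨h', h2'⟩
  · left; linarith
  · left; linarith
  · left; linarith
  · right; constructor <;> linarith

lemma mul_exp_mem_semiclosedUpperHalfPlane {m t : ℝ} (hm : 0 < m) (h0 : 0 < t) (h1 : t ≤ 1) :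
    (m : ℂ) * Complex.exp (Real.pi * t * Complex.I) ∈ semiclosedUpperHalfPlane := by
  have e : (Real.pi * t * Complex.I : ℂ) = ((Real.pi * t : ℝ) : ℂ) * Complex.I := by push_cast; rfl
  simp only [semiclosedUpperHalfPlane, Set.mem_ofPred_eq, e, Complex.re_ofReal_mul,
    Complex.im_ofReal_mul, Complex.exp_ofReal_mul_I_re, Complex.exp_ofReal_mul_I_im]
  rcases h1.lt_or_eq with h1 | rfl
  · left
    exact mul_pos hm (Real.sin_pos_of_pos_of_lt_pi (by positivity)
      (by nlinarith [Real.pi_pos]))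
  · right
    simp [hm]

namespace BridgelandStability

variable (σ : BridgelandStability D)

/-- Induction on the filtration: a factor of phase `φ` contributes `exp (iπθ)` times a number of
phase `φ - θ ∈ (0, 1]`, and such numbers form a set closed under addition. The first alternative
accounts for the empty filtration, since the half plane omits `0`. -/
lemma charge_mem_of_HN {θ : ℝ} {l : List ℝ} {E : C} (h : HNFiltration D σ.P l E)
    (hl : ∀ φ ∈ l, θ < φ ∧ φ ≤ θ + 1) (hE : D E) :
    (IsZero E ∧ σ.Z (classK ⟨E, hE⟩) = 0) ∨
      ∃ z ∈ semiclosedUpperHalfPlane,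
        σ.Z (classK ⟨E, hE⟩) = Complex.exp (Real.pi * θ * Complex.I) * z := by
  induction h with
  | zero E _ h0 => exact Or.inl ⟨h0, by rw [classK_of_isZero _ h0, map_zero]⟩
  | step F E Q f g h φ l hF _ hQ hQ0 _ hT ih =>
    right
    have hsum : σ.Z (classK ⟨E, hE⟩) = σ.Z (classK ⟨F, hF.mem⟩) +
        σ.Z (classK ⟨Q, σ.P_le φ Q hQ⟩) := by
      rw [← map_add]
      congr 1
      exact classK_of_distTriang ⟨F, hF.mem⟩ ⟨E, hE⟩ ⟨Q, σ.P_le φ Q hQ⟩ f g h hT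
    obtain ⟨m, hm, hmZ⟩ := σ.charge φ Q hQ hQ0
    obtain ⟨h1, h2⟩ := hl φ (by simp)
    have hq := mul_exp_mem_semiclosedUpperHalfPlane hm (t := φ - θ) (by linarith) (by linarith)
    have hqZ : σ.Z (classK ⟨Q, σ.P_le φ Q hQ⟩) = Complex.exp (Real.pi * θ * Complex.I) *
        (m * Complex.exp (Real.pi * ((φ - θ : ℝ) : ℂ) * Complex.I)) := by
      rw [hmZ, mul_left_comm, ← Complex.exp_add]
      congr 2
      push_cast
      ring
    rcases ih (fun ψ hψ => hl ψ (List.mem_cons_of_mem _ hψ)) hF.mem with ⟨_, h0⟩ | ⟨z, hz, hzZ⟩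
    · exact ⟨_, hq, by rw [hsum, h0, zero_add, hqZ]⟩
    · exact ⟨_, add_mem_semiclosedUpperHalfPlane hz hq, by rw [hsum, hzZ, hqZ, mul_add]⟩

lemma charge_ne_zero_of_heart {θ : ℝ} (E : D.FullSubcategory) (h : σ.heart θ E.obj)
    (h0 : ¬ IsZero E.obj) : σ.Z (classK E) ≠ 0 := by
  obtain ⟨l, hl, hφ⟩ := h
  rcases σ.charge_mem_of_HN hl hφ E.property with ⟨h, _⟩ | ⟨z, hz, hzZ⟩
  · exact absurd h h0
  · intro hZ
    have : z = 0 := by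
      have := hzZ.symm.trans hZ
      exact (mul_eq_zero.mp this).resolve_left (Complex.exp_ne_zero _)
    subst this
    simp [semiclosedUpperHalfPlane] at hz

lemma dilateRotate_heart_iff (c : ℂ) (θ : ℝ) (E : C) :
    (σ.dilateRotate c).heart (θ + c.im / Real.pi) E ↔ σ.heart θ E := by
  constructor
  · rintro ⟨l, hl, hφ⟩
    refine ⟨l.map (· + -(c.im / Real.pi)), ?_, ?_⟩
    · have h := hl.shift_phase (-(c.im / Real.pi))
      simpa [dilateRotate] using h
    · intro φ h
      obtain ⟨ψ, hψ, rfl⟩ := List.mem_map.mp h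
      have := hφ ψ hψ
      constructor <;> linarith
  · rintro ⟨l, hl, hφ⟩
    refine ⟨l.map (· + c.im / Real.pi), hl.shift_phase _, ?_⟩
    intro φ h
    obtain ⟨ψ, hψ, rfl⟩ := List.mem_map.mp h
    have := hφ ψ hψ
    constructor <;> linarith

end BridgelandStability

end HeartCharge

/-! ### The simple nilpotent representations -/

namespace NilRepK

section Subrepresentation

variable (M : NilRepK) (W₀ : Submodule ℂ M.V₀) (W₁ : Submodule ℂ M.V₁)
  (ha : ∀ x ∈ W₀, M.a x ∈ W₁) (hb : ∀ x ∈ W₀, M.b x ∈ W₁)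
  (ha' : ∀ x ∈ W₁, M.a' x ∈ W₀) (hb' : ∀ x ∈ W₁, M.b' x ∈ W₀)

lemma exists_arrowOperator_of_restrict (f : Module.End ℂ (W₀ × W₁))
    (hf : f ∈ arrowOperators (M.a.restrict ha) (M.b.restrict hb) (M.a'.restrict ha')
      (M.b'.restrict hb')) :
    ∃ g ∈ arrowOperators M.a M.b M.a' M.b',
      ∀ x, (W₀.subtype.prodMap W₁.subtype) (f x) = g ((W₀.subtype.prodMap W₁.subtype) x) := by
  simp only [arrowOperators, Set.mem_insert_iff, Set.mem_singleton_iff] at hf ⊢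
  rcases hf with rfl | rfl | rfl | rfl
  · exact ⟨_, Or.inl rfl, fun x => by simp⟩
  · exact ⟨_, Or.inr (Or.inl rfl), fun x => by simp⟩
  · exact ⟨_, Or.inr (Or.inr (Or.inl rfl)), fun x => by simp⟩
  · exact ⟨_, Or.inr (Or.inr (Or.inr rfl)), fun x => by simp⟩

/-- The subrepresentation on subspaces that are stable under the arrows. -/
def subrep : NilRepK where
  V₀ := W₀
  V₁ := W₁
  a := M.a.restrict ha
  b := M.b.restrict hb
  a' := M.a'.restrict ha'
  b' := M.b'.restrict hb'
  rel₀ := LinearMap.ext fun x => Subtype.ext congr($M.rel₀ x.1)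
  rel₁ := LinearMap.ext fun x => Subtype.ext congr($M.rel₁ x.1)
  nilpotent := by
    obtain ⟨N, hN⟩ := M.nilpotent
    -- A word in the restricted arrows is intertwined by the inclusion with a word of the same
    -- length in the arrows of `M`; hence the bound `N` for `M` also serves the subrepresentation.
    have key (l : List (Module.End ℂ (W₀ × W₁))) (hl : ∀ f ∈ l, f ∈ arrowOperators
        (M.a.restrict ha) (M.b.restrict hb) (M.a'.restrict ha') (M.b'.restrict hb')) :
        ∃ l' : List (Module.End ℂ (M.V₀ × M.V₁)),
          (∀ f ∈ l', f ∈ arrowOperators M.a M.b M.a' M.b') ∧ l'.length = l.length ∧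
          ∀ x, (W₀.subtype.prodMap W₁.subtype) (l.prod x) =
            l'.prod ((W₀.subtype.prodMap W₁.subtype) x) := by
      induction l with
      | nil => exact ⟨[], by simp, rfl, fun x => rfl⟩
      | cons f l ih =>
        obtain ⟨l', h1, h2, h3⟩ := ih fun g hg => hl g (List.mem_cons_of_mem _ hg)
        obtain ⟨g, hg, hfg⟩ := M.exists_arrowOperator_of_restrict W₀ W₁ ha hb ha' hb' f
          (hl f (by simp))
        refine ⟨g :: l', ?_, by simp [h2], fun x => ?_⟩
        · intro k hk
          rcases List.mem_cons.mp hk with rfl | hk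
          exacts [hg, h1 k hk]
        · rw [List.prod_cons, List.prod_cons, Module.End.mul_apply, Module.End.mul_apply, hfg, h3]
    refine ⟨N, fun l hl hlen => LinearMap.ext fun x => ?_⟩
    obtain ⟨l', h1, h2, h3⟩ := key l hl
    have h := h3 x
    rw [hN l' h1 (h2.trans hlen)] at h
    have hinj : Function.Injective (W₀.subtype.prodMap W₁.subtype) :=
      Prod.map_injective.mpr ⟨Subtype.val_injective, Subtype.val_injective⟩
    exact hinj (h.trans (map_zero _).symm)

/-- The inclusion of a subrepresentation. -/
def subrepIncl : M.subrep W₀ W₁ ha hb ha' hb' ⟶ M :=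
  { f₀ := W₀.subtype
    f₁ := W₁.subtype
    comm_a := rfl
    comm_b := rfl
    comm_a' := rfl
    comm_b' := rfl : Hom _ _ }

end Subrepresentation

/-- The kernels at the two vertices form a subrepresentation whose inclusion is killed by `f`;
cancelling the monomorphism makes this inclusion zero. -/
lemma injective_of_mono {M N : NilRepK} (f : M ⟶ N) [Mono f] :
    Function.Injective (Hom.f₀ f) ∧ Function.Injective (Hom.f₁ f) := by
  let i := M.subrepIncl (LinearMap.ker (Hom.f₀ f)) (LinearMap.ker (Hom.f₁ f))
    (fun x hx => by
      have h : Hom.f₁ f (M.a x) = N.a (Hom.f₀ f x) := congr($(Hom.comm_a f) x)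
      rw [LinearMap.mem_ker] at hx ⊢
      rw [h, hx, map_zero])
    (fun x hx => by
      have h : Hom.f₁ f (M.b x) = N.b (Hom.f₀ f x) := congr($(Hom.comm_b f) x)
      rw [LinearMap.mem_ker] at hx ⊢
      rw [h, hx, map_zero])
    (fun x hx => by
      have h : Hom.f₀ f (M.a' x) = N.a' (Hom.f₁ f x) := congr($(Hom.comm_a' f) x)
      rw [LinearMap.mem_ker] at hx ⊢
      rw [h, hx, map_zero])
    (fun x hx => by
      have h : Hom.f₀ f (M.b' x) = N.b' (Hom.f₁ f x) := congr($(Hom.comm_b' f) x)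
      rw [LinearMap.mem_ker] at hx ⊢
      rw [h, hx, map_zero])
  have hi : i = 0 := by
    rw [← cancel_mono f, zero_comp]
    exact Hom.ext (LinearMap.ext fun x => x.2) (LinearMap.ext fun x => x.2)
  constructor
  · rw [injective_iff_map_eq_zero]
    intro x hx
    exact congr((Hom.f₀ $hi) ⟨x, hx⟩)
  · rw [injective_iff_map_eq_zero]
    intro x hx
    exact congr((Hom.f₁ $hi) ⟨x, hx⟩)

lemma mono_of_injective {M N : NilRepK} (f : M ⟶ N) (h₀ : Function.Injective (Hom.f₀ f))
    (h₁ : Function.Injective (Hom.f₁ f)) : Mono f where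
  right_cancellation g h e := by
    refine Hom.ext (LinearMap.ext fun x => h₀ ?_) (LinearMap.ext fun x => h₁ ?_)
    · exact congr((Hom.f₀ $e) x)
    · exact congr((Hom.f₁ $e) x)

lemma comp_symm_eq {U V U' V' : Type} [AddCommGroup U] [Module ℂ U] [AddCommGroup V] [Module ℂ V]
    [AddCommGroup U'] [Module ℂ U'] [AddCommGroup V'] [Module ℂ V'] (e : U ≃ₗ[ℂ] V)
    (e' : U' ≃ₗ[ℂ] V') (s : U →ₗ[ℂ] U') (t : V →ₗ[ℂ] V')
    (h : e'.toLinearMap.comp s = t.comp e.toLinearMap) :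
    e'.symm.toLinearMap.comp t = s.comp e.symm.toLinearMap := by
  ext x
  have := congr($h (e.symm x))
  simp at this
  simp [← this]

lemma isIso_of_bijective {M N : NilRepK} (f : M ⟶ N) (h₀ : Function.Bijective (Hom.f₀ f))
    (h₁ : Function.Bijective (Hom.f₁ f)) : IsIso f := by
  let e₀ := LinearEquiv.ofBijective (Hom.f₀ f) h₀
  let e₁ := LinearEquiv.ofBijective (Hom.f₁ f) h₁
  let g : Hom N M :=
    { f₀ := e₀.symm
      f₁ := e₁.symm
      comm_a := comp_symm_eq e₀ e₁ _ _ (Hom.comm_a f)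
      comm_b := comp_symm_eq e₀ e₁ _ _ (Hom.comm_b f)
      comm_a' := comp_symm_eq e₁ e₀ _ _ (Hom.comm_a' f)
      comm_b' := comp_symm_eq e₁ e₀ _ _ (Hom.comm_b' f) }
  refine ⟨g, Hom.ext (LinearMap.ext fun x => ?_) (LinearMap.ext fun x => ?_),
    Hom.ext (LinearMap.ext fun x => ?_) (LinearMap.ext fun x => ?_)⟩
  · exact e₀.symm_apply_apply x
  · exact e₁.symm_apply_apply x
  · exact e₀.apply_symm_apply x
  · exact e₁.apply_symm_apply x

lemma id_simpleZero_ne_zero : 𝟙 simpleZero ≠ 0 := by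
  intro h
  have h1 : (1 : ℂ) = 0 := congr((Hom.f₀ $h) (1 : ℂ))
  exact one_ne_zero h1

lemma id_simpleOne_ne_zero : 𝟙 simpleOne ≠ 0 := by
  intro h
  have h1 : (1 : ℂ) = 0 := congr((Hom.f₁ $h) (1 : ℂ))
  exact one_ne_zero h1

/-- A nonzero linear map to the one-dimensional space `ℂ` is surjective, and the other vertex
carries the zero space; so a nonzero monomorphism is bijective at both vertices. -/
lemma simple_simpleZero : Simple simpleZero where
  mono_isIso_iff_nonzero {Y} f hf := by
    constructor
    · rintro h rfl
      apply id_simpleZero_ne_zero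
      rw [← IsIso.inv_hom_id (0 : Y ⟶ simpleZero), comp_zero]
    · intro h
      obtain ⟨i₀, i₁⟩ := injective_of_mono f
      refine isIso_of_bijective f ⟨i₀, ?_⟩ ⟨i₁, fun y => ⟨0, rfl⟩⟩
      refine LinearMap.surjective (f := Hom.f₀ f) fun h0 => h ?_
      exact Hom.ext h0 rfl

lemma simple_simpleOne : Simple simpleOne where
  mono_isIso_iff_nonzero {Y} f hf := by
    constructor
    · rintro h rfl
      apply id_simpleOne_ne_zero
      rw [← IsIso.inv_hom_id (0 : Y ⟶ simpleOne), comp_zero]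
    · intro h
      obtain ⟨i₀, i₁⟩ := injective_of_mono f
      refine isIso_of_bijective f ⟨i₀, fun y => ⟨0, rfl⟩⟩ ⟨i₁, ?_⟩
      refine LinearMap.surjective (f := Hom.f₁ f) fun h0 => h ?_
      exact Hom.ext rfl h0

lemma isEmpty_simpleZero_iso_simpleOne : IsEmpty (simpleZero ≅ simpleOne) :=
  ⟨fun e => id_simpleZero_ne_zero <| by
    have h : e.hom = 0 := Hom.ext rfl (LinearMap.ext fun (x : PUnit) => by
      obtain rfl : x = 0 := rfl
      exact map_zero _)
    rw [← e.hom_inv_id, h, zero_comp]⟩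

/-- Otherwise every nonzero vector concentrated at one vertex is moved by some arrow to a nonzero
vector, again concentrated at one vertex. Iterating gives nonvanishing paths of every length,
against nilpotency. -/
lemma exists_homogeneous_killed (S : NilRepK) (hS : 𝟙 S ≠ 0) :
    ∃ v : S.V₀ × S.V₁, v ≠ 0 ∧ (v.1 = 0 ∨ v.2 = 0) ∧
      ∀ f ∈ arrowOperators S.a S.b S.a' S.b', f v = 0 := by
  by_contra! H
  obtain ⟨N, hN⟩ := S.nilpotent
  obtain ⟨v, hv, hv'⟩ : ∃ v : S.V₀ × S.V₁, v ≠ 0 ∧ (v.1 = 0 ∨ v.2 = 0) := by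
    by_contra! H'
    refine hS (Hom.ext (LinearMap.ext fun x => ?_) (LinearMap.ext fun x => ?_))
    · by_contra hx
      exact (H' (x, 0) fun h => hx congr(Prod.fst $h)).2 rfl
    · by_contra hx
      exact (H' (0, x) fun h => hx congr(Prod.snd $h)).1 rfl
  have key (n : ℕ) : ∃ l : List (Module.End ℂ (S.V₀ × S.V₁)),
      (∀ f ∈ l, f ∈ arrowOperators S.a S.b S.a' S.b') ∧ l.length = n ∧ l.prod v ≠ 0 ∧
        ((l.prod v).1 = 0 ∨ (l.prod v).2 = 0) := by
    induction n with
    | zero => exact ⟨[], by simp, rfl, hv, hv'⟩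
    | succ n ih =>
      obtain ⟨l, h1, h2, h3, h4⟩ := ih
      obtain ⟨f, hf, hf0⟩ := H _ h3 h4
      refine ⟨f :: l, ?_, by simp [h2], hf0, ?_⟩
      · intro k hk
        rcases List.mem_cons.mp hk with rfl | hk
        exacts [hf, h1 k hk]
      · rw [List.prod_cons, Module.End.mul_apply]
        simp only [arrowOperators, Set.mem_insert_iff, Set.mem_singleton_iff] at hf
        rcases hf with rfl | rfl | rfl | rfl <;> simp
  obtain ⟨l, h1, h2, h3, -⟩ := key N
  exact h3 (by rw [hN l h1 h2]; rfl)

/-- The line spanned by a vector killed by all arrows is a subrepresentation isomorphic to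
`simpleZero` or `simpleOne`, depending on the vertex; its inclusion is a nonzero monomorphism into a
simple object, hence an isomorphism. -/
lemma iso_simple_of_simple (S : NilRepK) (hS : Simple S) :
    Nonempty (S ≅ simpleZero) ∨ Nonempty (S ≅ simpleOne) := by
  obtain ⟨v, hv, hv', hf⟩ := S.exists_homogeneous_killed (id_nonzero S)
  have ha : S.a v.1 = 0 := congr(Prod.snd $(hf _ (Or.inl rfl)))
  have hb : S.b v.1 = 0 := congr(Prod.snd $(hf _ (Or.inr (Or.inl rfl))))
  have ha' : S.a' v.2 = 0 := congr(Prod.fst $(hf _ (Or.inr (Or.inr (Or.inl rfl)))))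
  have hb' : S.b' v.2 = 0 := congr(Prod.fst $(hf _ (Or.inr (Or.inr (Or.inr rfl)))))
  rcases hv' with h | h
  · right
    have h2 : v.2 ≠ 0 := fun h2 => hv (Prod.ext h h2)
    let f : simpleOne ⟶ S :=
      { f₀ := 0
        f₁ := LinearMap.toSpanSingleton ℂ S.V₁ v.2
        comm_a := LinearMap.ext fun x => by change (0 : ℂ) • v.2 = S.a 0; simp
        comm_b := LinearMap.ext fun x => by change (0 : ℂ) • v.2 = S.b 0; simp
        comm_a' := LinearMap.ext fun (x : ℂ) => by
          change 0 = S.a' (x • v.2); rw [map_smul, ha', smul_zero]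
        comm_b' := LinearMap.ext fun (x : ℂ) => by
          change 0 = S.b' (x • v.2); rw [map_smul, hb', smul_zero] : Hom _ _ }
    have : Mono f := mono_of_injective f (fun (x y : PUnit) _ => rfl) (smul_left_injective ℂ h2)
    have : IsIso f := (hS.mono_isIso_iff_nonzero f).mpr fun h0 => h2 <| by
      have : (1 : ℂ) • v.2 = 0 := congr((Hom.f₁ $h0) (1 : ℂ))
      simpa using this
    exact ⟨(asIso f).symm⟩
  · left
    have h2 : v.1 ≠ 0 := fun h2 => hv (Prod.ext h2 h)
    let f : simpleZero ⟶ S :=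
      { f₀ := LinearMap.toSpanSingleton ℂ S.V₀ v.1
        f₁ := 0
        comm_a := LinearMap.ext fun (x : ℂ) => by
          change 0 = S.a (x • v.1); rw [map_smul, ha, smul_zero]
        comm_b := LinearMap.ext fun (x : ℂ) => by
          change 0 = S.b (x • v.1); rw [map_smul, hb, smul_zero]
        comm_a' := LinearMap.ext fun x => by change (0 : ℂ) • v.1 = S.a' 0; simp
        comm_b' := LinearMap.ext fun x => by change (0 : ℂ) • v.1 = S.b' 0; simp : Hom _ _ }
    have : Mono f := mono_of_injective f (smul_left_injective ℂ h2) (fun (x y : PUnit) _ => rfl)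
    have : IsIso f := (hS.mono_isIso_iff_nonzero f).mpr fun h0 => h2 <| by
      have : (1 : ℂ) • v.1 = 0 := congr((Hom.f₀ $h0) (1 : ℂ))
      simpa using this
    exact ⟨(asIso f).symm⟩

end NilRepK

/-! ### Sheaves of modules through their sections -/

section Modules

variable {X Y : Scheme.{0}}

/-- The sections over an open set, as a functor to abelian groups. -/
def sectionsOver (X : Scheme.{0}) (U : X.Opens) : X.Modules ⥤ Ab :=
  Scheme.Modules.toPresheaf X ⋙ (evaluation _ _).obj (.op U)

instance (U : X.Opens) : PreservesLimits (sectionsOver X U) :=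
  have : PreservesLimits ((evaluation X.Opensᵒᵖ Ab.{0}).obj (.op U)) :=
    ⟨fun {_} => inferInstance⟩
  comp_preservesLimits (Scheme.Modules.toPresheaf X) ((evaluation X.Opensᵒᵖ Ab.{0}).obj (.op U))

instance (U : X.Opens) : PreservesFiniteLimits (sectionsOver X U) :=
  PreservesLimits.preservesFiniteLimits _

instance (U : X.Opens) : (sectionsOver X U).PreservesZeroMorphisms where
  map_zero _ _ := rfl

lemma app_injective_of_mono {A B : X.Modules} (f : A ⟶ B) [Mono f] (U : X.Opens) :
    Function.Injective (f.app U) :=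
  (AddCommGrpCat.mono_iff_injective _).mp (inferInstanceAs (Mono ((sectionsOver X U).map f)))

lemma exists_app_kernel_ι {B C : X.Modules} (g : B ⟶ C) (U : X.Opens) (b : Γ(B, U))
    (hb : g.app U b = 0) : ∃ a : Γ(kernel g, U), (kernel.ι g).app U a = b := by
  let S : ShortComplex X.Modules := ShortComplex.mk (kernel.ι g) g (kernel.condition g)
  have hS : S.Exact := S.exact_of_f_is_kernel (kernelIsKernel g)
  have : Mono S.f := inferInstanceAs (Mono (kernel.ι g))
  have h := hS.map_of_mono_of_preservesKernel (sectionsOver X U) inferInstance inferInstance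
  rw [ShortComplex.ab_exact_iff] at h
  exact h b hb

/-- Taking sections is left exact, so under these conditions the comparison map to the categorical
kernel is bijective on sections over every open set. -/
lemma nonempty_isLimit_kernelFork_of_sections {A B C : X.Modules} (f : A ⟶ B) (g : B ⟶ C)
    (w : f ≫ g = 0) (hf : ∀ U, Function.Injective (f.app U))
    (hg : ∀ U (b : Γ(B, U)), g.app U b = 0 → ∃ a, f.app U a = b) :
    Nonempty (IsLimit (KernelFork.ofι f w)) := by
  have hk : kernel.lift g f w ≫ kernel.ι g = f := kernel.lift_ι _ _ _
  have hk' (U : X.Opens) (a : Γ(A, U)) :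
      (kernel.ι g).app U ((kernel.lift g f w).app U a) = f.app U a := by
    rw [← ConcreteCategory.comp_apply, ← Scheme.Modules.Hom.comp_app, hk]
  have : IsIso (kernel.lift g f w) := by
    rw [Scheme.Modules.Hom.isIso_iff_isIso_app]
    intro U
    rw [ConcreteCategory.isIso_iff_bijective]
    constructor
    · intro a a' h
      apply hf U
      rw [← hk', ← hk', h]
    · intro b
      obtain ⟨a, ha⟩ := hg U ((kernel.ι g).app U b) (by
        rw [← ConcreteCategory.comp_apply, ← Scheme.Modules.Hom.comp_app, kernel.condition]
        rfl)
      exact ⟨a, app_injective_of_mono (kernel.ι g) U ((hk' U a).trans ha)⟩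
  exact ⟨IsLimit.ofIsoLimit (kernelIsKernel g) (Fork.ext (asIso (kernel.lift g f w)).symm
    ((Iso.inv_comp_eq _).mpr hk.symm))⟩

/-- Local surjectivity characterises epimorphisms of abelian sheaves, and the forgetful functor from
sheaves of modules reflects epimorphisms. -/
lemma epi_of_locally_surjective {A B : X.Modules} (g : A ⟶ B)
    (h : ∀ (U : X.Opens) (b : Γ(B, U)) (x : X), x ∈ U → ∃ (V : X.Opens) (hV : V ≤ U) (a : Γ(A, V)),
      x ∈ V ∧ g.app V a = B.presheaf.map (homOfLE hV).op b) : Epi g := by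
  have h1 : TopCat.Presheaf.IsLocallySurjective
      ((SheafOfModules.toSheaf X.ringCatSheaf).map g).hom := by
    rw [TopCat.Presheaf.isLocallySurjective_iff]
    intro U b x hx
    obtain ⟨V, hV, a, hxV, ha⟩ := h U b x hx
    exact ⟨V, hV, ⟨a, ha⟩, hxV⟩
  have h2 : Epi ((SheafOfModules.toSheaf X.ringCatSheaf).map g) :=
    (TopCat.Sheaf.isLocallySurjective_iff_epi _).mp h1
  exact (SheafOfModules.toSheaf X.ringCatSheaf).epi_of_epi_map h2

lemma mulPullback_app (f : X ⟶ Y) (s : Γ(X, ⊤)) (U : Y.Opens) (r : Γ(Y, U)) :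
    (mulPullback f s).app U r =
      (f.app U r * X.presheaf.map (homOfLE le_top).op s : Γ(X, f ⁻¹ᵁ U)) := by
  rfl

end Modules

/-! ### The skyscraper sequence of a principal prime ideal -/

section PrincipalIdealDomain

/-- Multiplication by a global function on the structure sheaf. -/
def mulUnit {X : Scheme.{0}} (s : Γ(X, ⊤)) : structureModule X ⟶ structureModule X :=
  mulPullback (𝟙 X) s ≫ (Scheme.Modules.pushforwardId X).hom.app _

/-- The function on an open subset of `Spec R` that is given by an element of `R`. -/
def specSection (R : CommRingCat.{0}) (U : (Spec R).Opens) : R →+* Γ(Spec R, U) :=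
  ((Scheme.ΓSpecIso R).inv ≫ (Spec R).presheaf.map (homOfLE le_top).op).hom

lemma Spec_map_app_specSection {R S : CommRingCat.{0}} (φ : R ⟶ S) (U : (Spec R).Opens) (a : R) :
    (Spec.map φ).app U (specSection R U a) = specSection S (Spec.map φ ⁻¹ᵁ U) (φ a) := by
  have h1 := congr($(Scheme.ΓSpecIso_inv_naturality φ) a)
  simp only [CommRingCat.comp_apply] at h1
  have h2 := congr($((Spec.map φ).naturality (homOfLE (le_top : U ≤ ⊤)).op)
    ((Scheme.ΓSpecIso R).inv a))
  refine h2.trans ?_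
  exact congr((Spec S).presheaf.map (homOfLE (le_top : Spec.map φ ⁻¹ᵁ U ≤ ⊤)).op $h1).symm

/-- The complement is the zero locus of a principal ideal. Thus sections over any open subset of the
chart are fractions with powers of a single `g` as denominators, and exactness can be tested on all
open sets directly. -/
lemma exists_eq_basicOpen {R : Type} [CommRing R] [IsPrincipalIdealRing R]
    (U : TopologicalSpace.Opens (PrimeSpectrum R)) :
    ∃ g : R, U = PrimeSpectrum.basicOpen g := by
  obtain ⟨I, hI⟩ := (PrimeSpectrum.isClosed_iff_zeroLocus_ideal _).mp U.isOpen.isClosed_compl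
  obtain ⟨g, rfl⟩ := (IsPrincipalIdealRing.principal I).principal
  refine ⟨g, TopologicalSpace.Opens.ext ?_⟩
  rw [PrimeSpectrum.basicOpen_eq_zeroLocus_compl, ← PrimeSpectrum.zeroLocus_span]
  exact (compl_eq_comm.mp hI).symm

lemma specSection_injective {R : CommRingCat.{0}} [IsDomain R] (U : (Spec R).Opens)
    (x : Spec R) (hx : x ∈ U) : Function.Injective (specSection R U) := by
  have : Nonempty U := ⟨x, hx⟩
  exact (map_injective_of_isIntegral (Spec R) (homOfLE (le_top : U ≤ ⊤))).comp
    (ConcreteCategory.bijective_of_isIso (Scheme.ΓSpecIso R).inv).1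

/-- The open subset of `Spec R` where `g` does not vanish. -/
def specBasicOpen {R : CommRingCat.{0}} (g : R) : (Spec R).Opens := PrimeSpectrum.basicOpen g

lemma isLocalization_specBasicOpen {R : CommRingCat.{0}} (g : R) :
    IsLocalization.Away g Γ(Spec R, specBasicOpen g) :=
  StructureSheaf.IsLocalization.to_basicOpen R g

lemma isUnit_specSection {R : CommRingCat.{0}} (g : R) :
    IsUnit (specSection R (specBasicOpen g) g) :=
  have := isLocalization_specBasicOpen g
  IsLocalization.Away.algebraMap_isUnit (S := Γ(Spec R, specBasicOpen g)) g

lemma exists_mul_specSection_pow {R : CommRingCat.{0}} (g : R)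
    (r : Γ(Spec R, specBasicOpen g)) :
    ∃ (n : ℕ) (f : R), r * specSection R _ (g ^ n) = specSection R _ f := by
  have := isLocalization_specBasicOpen g
  obtain ⟨f, ⟨_, n, rfl⟩, hr⟩ := IsLocalization.exists_mk'_eq (Submonoid.powers g) r
  refine ⟨n, f, ?_⟩
  rw [← hr]
  exact IsLocalization.mk'_spec _ _ _

variable {R K : CommRingCat.{0}}

/-- Multiplication by an element of `R` on the structure sheaf of `Spec R`. -/
def mulSpec (p : R) : structureModule (Spec R) ⟶ structureModule (Spec R) :=
  mulUnit ((Scheme.ΓSpecIso R).inv p)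

lemma mulSpec_app_injective [IsDomain R] {p : R} (hp : p ≠ 0) (U : (Spec R).Opens) :
    Function.Injective ((mulSpec p).app U) := by
  rw [injective_iff_map_eq_zero]
  intro (r : Γ(Spec R, U)) (h : r * specSection R U p = 0)
  by_cases hU : Nonempty U
  · obtain ⟨x, hx⟩ := hU
    have : Nonempty U := ⟨x, hx⟩
    refine (mul_eq_zero.mp h).resolve_right fun h0 => hp ?_
    exact specSection_injective U x hx (h0.trans (map_zero _).symm)
  -- Over the empty set there is only one section.
  · obtain rfl : U = ⊥ := by
      ext x
      exact ⟨fun hx => (hU ⟨x, hx⟩).elim, fun hx => hx.elim⟩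
    exact Subsingleton.elim (α := Γ(Spec R, ⊥)) _ _

/-- Write `U = D(g)`; the kernel of `φ` is `(p)`. If `p ∣ g`, then `p` is invertible on `U` and
there is nothing to divide. Otherwise `r = f / g ^ n`, and the vanishing of the image of `r` forces
`φ f = 0`, so `p ∣ f`. -/
lemma exists_mulSpec_app_eq [IsPrincipalIdealRing R] [IsDomain K] (φ : R ⟶ K) {p : R}
    (hφ : ∀ f, φ f = 0 ↔ p ∣ f) (U : (Spec R).Opens) (r : Γ(Spec R, U))
    (h : (mulPullback (Spec.map φ) 1).app U r = 0) : ∃ t, (mulSpec p).app U t = r := by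
  suffices ∃ t : Γ(Spec R, U), t * specSection R U p = r from this
  have h0 : (Spec.map φ).app U r = 0 := by
    have h' := (mulPullback_app (Spec.map φ) 1 U r).symm.trans h
    rw [map_one, mul_one] at h'
    exact h'
  clear h
  obtain ⟨g, rfl⟩ : ∃ g : R, U = specBasicOpen g := exists_eq_basicOpen (R := R) U
  by_cases hg : φ g = 0
  · obtain ⟨g', hg'⟩ := (hφ g).mp hg
    have hu := isUnit_specSection g
    have hg'' : specSection R (specBasicOpen g) g = _ := congr(specSection R _ $hg')
    rw [hg'', map_mul] at hu
    obtain ⟨u, hu⟩ := isUnit_of_mul_isUnit_left hu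
    exact ⟨r * (u⁻¹).val, by rw [← hu, mul_assoc, Units.inv_mul, mul_one]⟩
  · obtain ⟨n, f, hrf⟩ := exists_mul_specSection_pow g r
    have hf : φ f = 0 := by
      have h1 : (Spec.map φ).app (specBasicOpen g) (specSection R _ f) = 0 := by
        rw [← hrf, map_mul, h0, zero_mul]
      have h2 := (Spec_map_app_specSection φ (specBasicOpen g) f).symm.trans h1
      -- As `φ g ≠ 0`, the generic point of `Spec K` lies over `D(g)`; this open set is therefore
      -- nonempty and `K` embeds in its functions.
      refine specSection_injective (R := K) _ (⊥ : PrimeSpectrum K) ?_ (h2.trans (map_zero _).symm)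
      exact hg
    obtain ⟨f', rfl⟩ := (hφ f).mp hf
    obtain ⟨u, hu⟩ := (isUnit_specSection g).pow n
    rw [map_pow, ← hu, map_mul] at hrf
    refine ⟨specSection R _ f' * (u⁻¹).val, ?_⟩
    rw [mul_right_comm, mul_comm (specSection R _ f') (specSection R _ p), ← hrf, mul_assoc, Units.mul_inv, mul_one]

end PrincipalIdealDomain

/-! ### The line bundles `𝒪(-2)` and `𝒪(-1)` on `ℙ¹` -/

section KernelOfBiproduct

variable {A : Type u} [Category.{v} A] [Abelian A] {A₀ A₁ B Q : A}
  (z : A₀ ⟶ A₀) (e : A₀ ⟶ Q) (w : z ≫ e = 0) (hz : IsLimit (KernelFork.ofι z w))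
  (s : A₀ ⟶ B) (t t' : A₁ ⟶ B) (ζ : B ⟶ B) (hs : z ≫ s = s ≫ ζ) (ht : t' = t ≫ ζ)

include hs ht in
lemma biprod_map_comp_desc :
    biprod.desc s t ≫ ζ = biprod.map z (𝟙 A₁) ≫ biprod.desc s t' := by
  subst ht
  ext <;> simp [hs]

/-- The map between kernels that is induced by `z` on the first summand and by the identity on
the second summand. -/
def kernelDescMap : kernel (biprod.desc s t) ⟶ kernel (biprod.desc s t') :=
  kernel.map _ _ (biprod.map z (𝟙 A₁)) ζ (biprod_map_comp_desc z s t t' ζ hs ht)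

include w in
lemma kernelDescMap_comp : kernelDescMap z s t t' ζ hs ht ≫
    kernel.ι (biprod.desc s t') ≫ biprod.fst ≫ e = 0 := by
  simp [kernelDescMap, w]

include hz in
-- A map to the second kernel killed by evaluation has first component divisible by `z`. Dividing
-- it, with the second component unchanged, gives a pair satisfying the gluing equation for `t`
-- after composition with `ζ`, hence before it because `ζ` is a monomorphism.
lemma nonempty_isLimit_kernelDescMap [Mono ζ] :
    Nonempty (IsLimit (KernelFork.ofι (kernelDescMap z s t t' ζ hs ht)
      (kernelDescMap_comp z e w s t t' ζ hs ht))) := by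
  have : Mono z := mono_of_isLimit_fork hz
  have : Mono (kernelDescMap z s t t' ζ hs ht) := by
    have h : kernelDescMap z s t t' ζ hs ht ≫ kernel.ι _ = kernel.ι _ ≫ biprod.map z (𝟙 A₁) := by
      simp [kernelDescMap]
    have : Mono (kernelDescMap z s t t' ζ hs ht ≫ kernel.ι _) := by
      rw [h]
      infer_instance
    exact mono_of_mono _ (kernel.ι _)
  refine ⟨KernelFork.IsLimit.ofι' _ _ fun {W} k hk => ?_⟩
  have hk' : (k ≫ kernel.ι _ ≫ biprod.fst) ≫ e = 0 := by simpa using hk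
  let l₀ : W ⟶ A₀ := hz.lift (KernelFork.ofι _ hk')
  have hl₀ : l₀ ≫ z = k ≫ kernel.ι _ ≫ biprod.fst := hz.fac _ WalkingParallelPair.zero
  let l : W ⟶ A₀ ⊞ A₁ := biprod.lift l₀ (k ≫ kernel.ι _ ≫ biprod.snd)
  have hl : l ≫ biprod.map z (𝟙 A₁) = k ≫ kernel.ι _ := by
    ext <;> simp [l, hl₀]
  have hl' : l ≫ biprod.desc s t = 0 := by
    rw [← cancel_mono ζ, Category.assoc, biprod_map_comp_desc z s t t' ζ hs ht, reassoc_of% hl]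
    simp
  refine ⟨kernel.lift _ l hl', ?_⟩
  rw [← cancel_mono (kernel.ι _)]
  simp [kernelDescMap, hl]

end KernelOfBiproduct

/-! ### Multiplication by functions and the two components of the Čech differential. -/

lemma mulUnit_comp {X : Scheme.{0}} (s t : Γ(X, ⊤)) : mulUnit s ≫ mulUnit t = mulUnit (s * t) := by
  refine Scheme.Modules.hom_ext _ _ fun U => ?_
  ext (r : Γ(X, U))
  change r * X.presheaf.map _ s * X.presheaf.map _ t = r * X.presheaf.map _ (s * t)
  rw [map_mul, mul_assoc]

lemma mulUnit_one (X : Scheme.{0}) : mulUnit (1 : Γ(X, ⊤)) = 𝟙 _ := by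
  refine Scheme.Modules.hom_ext _ _ fun U => ?_
  ext (r : Γ(X, U))
  change r * X.presheaf.map _ 1 = r
  rw [map_one, mul_one]

lemma isIso_mulUnit {X : Scheme.{0}} {s t : Γ(X, ⊤)} (h : s * t = 1) : IsIso (mulUnit s) :=
  ⟨mulUnit t, by rw [mulUnit_comp, h, mulUnit_one],
    by rw [mulUnit_comp, mul_comm, h, mulUnit_one]⟩

lemma overlapMonomial_mul (m n : ℤ) :
    overlapMonomial m * overlapMonomial n = overlapMonomial (m + n) := by
  rw [overlapMonomial, overlapMonomial, ← map_mul, ← LaurentPolynomial.T_add]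
  rfl

lemma overlapMonomial_zero : overlapMonomial 0 = 1 := by
  rw [overlapMonomial, LaurentPolynomial.T_zero]
  exact map_one (Scheme.ΓSpecIso ringG).inv.hom

/-- Restriction of functions from the first chart of `ℙ¹` to the overlap. -/
def cechZero : (Scheme.Modules.pushforward chartZero).obj (structureModule (Spec ringA)) ⟶
    (Scheme.Modules.pushforward (overlapZero ≫ chartZero)).obj (structureModule (Spec ringG)) :=
  (Scheme.Modules.pushforward chartZero).map (mulPullback overlapZero 1) ≫
    (Scheme.Modules.pushforwardComp overlapZero chartZero).hom.app _

/-- Restriction of functions from the second chart of `ℙ¹` to the overlap, followed by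
multiplication by `z ^ d`. -/
def cechOne (d : ℤ) :
    (Scheme.Modules.pushforward chartOne).obj (structureModule (Spec ringA)) ⟶
    (Scheme.Modules.pushforward (overlapZero ≫ chartZero)).obj (structureModule (Spec ringG)) :=
  (Scheme.Modules.pushforward chartOne).map (mulPullback overlapOne (overlapMonomial d)) ≫
    (Scheme.Modules.pushforwardComp overlapOne chartOne).hom.app _ ≫
    (Scheme.Modules.pushforwardCongr overlap_condition.symm).hom.app _

lemma cechDifferential_eq (d : ℤ) : cechDifferential d = biprod.desc cechZero (-cechOne d) := rfl

lemma cechZero_app (U : P1.Opens) (r : Γ(Spec ringA, chartZero ⁻¹ᵁ U)) :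
    cechZero.app U r = overlapZero.app (chartZero ⁻¹ᵁ U) r := by
  change overlapZero.app (chartZero ⁻¹ᵁ U) r * (Spec ringG).presheaf.map _ 1 = _
  rw [map_one, mul_one]

lemma overlap_preimage (U : P1.Opens) :
    overlapZero ⁻¹ᵁ chartZero ⁻¹ᵁ U = overlapOne ⁻¹ᵁ chartOne ⁻¹ᵁ U :=
  congr($overlap_condition ⁻¹ᵁ U)

lemma cechOne_app (d : ℤ) (U : P1.Opens) (r : Γ(Spec ringA, chartOne ⁻¹ᵁ U)) :
    (cechOne d).app U r =
      ((Spec ringG).presheaf.map (eqToHom (overlap_preimage U)).op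
        (overlapOne.app (chartOne ⁻¹ᵁ U) r) *
        (Spec ringG).presheaf.map (homOfLE le_top).op (overlapMonomial d) :
        Γ(Spec ringG, overlapZero ⁻¹ᵁ chartZero ⁻¹ᵁ U)) := by
  change (Spec ringG).presheaf.map (eqToHom (overlap_preimage U)).op
    (overlapOne.app (chartOne ⁻¹ᵁ U) r *
      (Spec ringG).presheaf.map (homOfLE le_top).op (overlapMonomial d)) = _
  rw [map_mul]
  congr 1

/-- Multiplication by the coordinate `z` on functions on the first chart of `ℙ¹`. -/
def mulCoordZero : (Scheme.Modules.pushforward chartZero).obj (structureModule (Spec ringA)) ⟶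
    (Scheme.Modules.pushforward chartZero).obj (structureModule (Spec ringA)) :=
  (Scheme.Modules.pushforward chartZero).map (mulSpec (R := ringA) Polynomial.X)

/-- Multiplication by the coordinate `z` on functions on the overlap of the charts of `ℙ¹`. -/
def mulCoordOverlap :
    (Scheme.Modules.pushforward (overlapZero ≫ chartZero)).obj (structureModule (Spec ringG)) ⟶
    (Scheme.Modules.pushforward (overlapZero ≫ chartZero)).obj (structureModule (Spec ringG)) :=
  (Scheme.Modules.pushforward (overlapZero ≫ chartZero)).map (mulUnit (overlapMonomial 1))

/-- The coordinate `z` is invertible on the overlap, with inverse `z⁻¹`. This supplies the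
monomorphism `ζ` of the abstract kernel lemma. -/
instance : IsIso mulCoordOverlap :=
  have : IsIso (mulUnit (overlapMonomial 1)) :=
    isIso_mulUnit (t := overlapMonomial (-1)) (by
      rw [overlapMonomial_mul, ← overlapMonomial_zero, add_neg_cancel])
  inferInstanceAs (IsIso ((Scheme.Modules.pushforward _).map _))

lemma mulCoordOverlap_app (U : P1.Opens) (r : Γ(Spec ringG, overlapZero ⁻¹ᵁ chartZero ⁻¹ᵁ U)) :
    mulCoordOverlap.app U r = (r * (Spec ringG).presheaf.map (homOfLE le_top).op
      (overlapMonomial 1) : Γ(Spec ringG, overlapZero ⁻¹ᵁ chartZero ⁻¹ᵁ U)) :=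
  rfl

lemma inclA_X : inclA (Polynomial.X : Polynomial ℂ) = LaurentPolynomial.T 1 :=
  Polynomial.toLaurent_X

lemma mulCoordZero_app (U : P1.Opens) (r : Γ(Spec ringA, chartZero ⁻¹ᵁ U)) :
    mulCoordZero.app U r = (r * specSection ringA _ (Polynomial.X : Polynomial ℂ) :
      Γ(Spec ringA, chartZero ⁻¹ᵁ U)) :=
  rfl

lemma overlapZero_app_coord (V : (Spec ringA).Opens) :
    overlapZero.app V (specSection ringA V (Polynomial.X : Polynomial ℂ)) =
      (Spec ringG).presheaf.map (homOfLE le_top).op (overlapMonomial 1) :=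
  (Spec_map_app_specSection inclA V (Polynomial.X : Polynomial ℂ)).trans
    congr(specSection ringG _ $inclA_X)

lemma mulCoordZero_comp_cechZero : mulCoordZero ≫ cechZero = cechZero ≫ mulCoordOverlap := by
  refine Scheme.Modules.hom_ext _ _ fun U => ?_
  refine AddCommGrpCat.hom_ext (AddMonoidHom.ext fun (r : Γ(Spec ringA, chartZero ⁻¹ᵁ U)) => ?_)
  change cechZero.app U (mulCoordZero.app U r) = mulCoordOverlap.app U (cechZero.app U r)
  rw [mulCoordZero_app, cechZero_app, cechZero_app, mulCoordOverlap_app]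
  exact (map_mul (overlapZero.app (chartZero ⁻¹ᵁ U)).hom _ _).trans
    congr(_ * $(overlapZero_app_coord _))

/-- This is where the degree rises by one: multiplying by `z` on the overlap changes the gluing
function `z ^ d` to `z ^ (d + 1)`. -/
lemma cechOne_comp_mulCoordOverlap (d : ℤ) :
    cechOne d ≫ mulCoordOverlap = cechOne (d + 1) := by
  refine Scheme.Modules.hom_ext _ _ fun U => ?_
  ext (r : Γ(Spec ringA, chartOne ⁻¹ᵁ U))
  change mulCoordOverlap.app U ((cechOne d).app U r) = (cechOne (d + 1)).app U r
  rw [cechOne_app, cechOne_app, mulCoordOverlap_app, mul_assoc, ← map_mul, overlapMonomial_mul]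

/-! ### Evaluation at the origin and left exactness of the sequence on `ℙ¹`. -/

/-- The origin of the first chart of `ℙ¹`. -/
def originA : Spec (CommRingCat.of ℂ) ⟶ Spec ringA :=
  Spec.map (CommRingCat.ofHom (Polynomial.evalRingHom (0 : ℂ)))

/-- The value at the origin of functions on the first chart of `ℙ¹`. -/
def evalOrigin : (Scheme.Modules.pushforward chartZero).obj (structureModule (Spec ringA)) ⟶
    (Scheme.Modules.pushforward (originA ≫ chartZero)).obj
      (structureModule (Spec (CommRingCat.of ℂ))) :=
  (Scheme.Modules.pushforward chartZero).map (mulPullback originA 1) ≫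
    (Scheme.Modules.pushforwardComp originA chartZero).hom.app _

lemma X_ne_zero_ringA : (Polynomial.X : Polynomial ℂ) ≠ 0 := Polynomial.X_ne_zero

instance : IsDomain ringA := inferInstanceAs (IsDomain (Polynomial ℂ))

instance : IsPrincipalIdealRing ringA := inferInstanceAs (IsPrincipalIdealRing (Polynomial ℂ))

instance : IsDomain (CommRingCat.of ℂ) := inferInstanceAs (IsDomain ℂ)

lemma evalRingHom_eq_zero_iff (f : Polynomial ℂ) :
    Polynomial.evalRingHom (0 : ℂ) f = 0 ↔ Polynomial.X ∣ f := by
  rw [Polynomial.X_dvd_iff, Polynomial.coeff_zero_eq_eval_zero]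
  rfl

lemma evalOrigin_app (U : P1.Opens) (r : Γ(Spec ringA, chartZero ⁻¹ᵁ U)) :
    evalOrigin.app U r = originA.app (chartZero ⁻¹ᵁ U) r := by
  change originA.app (chartZero ⁻¹ᵁ U) r * (Spec (CommRingCat.of ℂ)).presheaf.map _ 1 = _
  rw [map_one, mul_one]

lemma originA_app_specSection (V : (Spec ringA).Opens) (f : Polynomial ℂ) :
    originA.app V (specSection ringA V f) =
      specSection (CommRingCat.of ℂ) (originA ⁻¹ᵁ V) (Polynomial.evalRingHom (0 : ℂ) f) :=
  Spec_map_app_specSection _ V f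

lemma mulCoordZero_comp_evalOrigin : mulCoordZero ≫ evalOrigin = 0 := by
  refine Scheme.Modules.hom_ext _ _ fun U => ?_
  refine AddCommGrpCat.hom_ext (AddMonoidHom.ext fun (r : Γ(Spec ringA, chartZero ⁻¹ᵁ U)) => ?_)
  change evalOrigin.app U (mulCoordZero.app U r) = 0
  rw [mulCoordZero_app, evalOrigin_app]
  refine (map_mul (originA.app (chartZero ⁻¹ᵁ U)).hom _ _).trans (mul_eq_zero_of_right _ ?_)
  refine (originA_app_specSection _ _).trans ?_
  rw [(evalRingHom_eq_zero_iff _).mpr dvd_rfl, map_zero]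

lemma nonempty_isLimit_mulCoordZero :
    Nonempty (IsLimit (KernelFork.ofι mulCoordZero mulCoordZero_comp_evalOrigin)) := by
  refine nonempty_isLimit_kernelFork_of_sections _ _ _
    (fun U => mulSpec_app_injective (R := ringA) X_ne_zero_ringA (chartZero ⁻¹ᵁ U))
    fun U r hr => ?_
  exact exists_mulSpec_app_eq (R := ringA) (K := CommRingCat.of ℂ)
    (CommRingCat.ofHom (Polynomial.evalRingHom (0 : ℂ))) evalRingHom_eq_zero_iff
    (chartZero ⁻¹ᵁ U) r hr

/-- The map `𝒪(-2) ⟶ 𝒪(-1)` that vanishes at the origin. -/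
def lineBundleMap : lineBundle (-2) ⟶ lineBundle (-1) :=
  kernelDescMap mulCoordZero cechZero (-cechOne (-2)) (-cechOne (-1)) mulCoordOverlap
    mulCoordZero_comp_cechZero (by
      rw [Preadditive.neg_comp, cechOne_comp_mulCoordOverlap]
      rfl)

/-- The value of sections of `𝒪(-1)` at the origin. -/
def lineBundleEval : lineBundle (-1) ⟶ (Scheme.Modules.pushforward (originA ≫ chartZero)).obj
    (structureModule (Spec (CommRingCat.of ℂ))) :=
  kernel.ι (cechDifferential (-1)) ≫ biprod.fst ≫ evalOrigin

lemma exact_lineBundleMap : ∃ w : lineBundleMap ≫ lineBundleEval = 0,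
    Nonempty (IsLimit (KernelFork.ofι lineBundleMap w)) := by
  obtain ⟨h⟩ := nonempty_isLimit_mulCoordZero
  exact ⟨_, nonempty_isLimit_kernelDescMap mulCoordZero evalOrigin _ h cechZero (-cechOne (-2))
    (-cechOne (-1)) mulCoordOverlap mulCoordZero_comp_cechZero _⟩

/-! ### Gluing two schemes along an open subscheme -/

section Gluing

variable {U X Y : Scheme.{0}} (f : U ⟶ X) (g : U ⟶ Y) [IsOpenImmersion f] [IsOpenImmersion g]

instance isOpenImmersion_pushout_inl : IsOpenImmersion (pushout.inl f g) :=
  inferInstanceAs (IsOpenImmersion (colimit.ι (span f g) WalkingSpan.left))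

instance isOpenImmersion_pushout_inr : IsOpenImmersion (pushout.inr f g) :=
  inferInstanceAs (IsOpenImmersion (colimit.ι (span f g) WalkingSpan.right))

lemma mem_range_or_mem_range_of_pushout (p : (pushout f g : Scheme.{0})) :
    p ∈ (pushout.inl f g).opensRange ∨ p ∈ (pushout.inr f g).opensRange := by
  obtain ⟨i, x, rfl⟩ := Scheme.IsLocallyDirected.ι_jointly_surjective (span f g) p
  rcases i with _ | _ | _
  · left
    refine ⟨f x, ?_⟩
    exact congr($(colimit.w (span f g) WalkingSpan.Hom.fst) x)
  · exact Or.inl ⟨x, rfl⟩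
  · exact Or.inr ⟨x, rfl⟩

/-- Points of different charts are identified only through an index of the span that maps to both
legs. The apex is the only such index, as there is no morphism between the legs. -/
lemma exists_of_pushout_inl_eq_inr {x : X} {y : Y} (h : pushout.inl f g x = pushout.inr f g y) :
    ∃ u : U, f u = x ∧ g u = y := by
  obtain ⟨k, fi, fj, u, hx, hy⟩ := (Scheme.IsLocallyDirected.ι_eq_ι_iff (span f g)
    (i := WalkingSpan.left) (j := WalkingSpan.right)).mp h
  rcases k with _ | _ | _
  · obtain rfl : fi = WalkingSpan.Hom.fst := Subsingleton.elim _ _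
    obtain rfl : fj = WalkingSpan.Hom.snd := Subsingleton.elim _ _
    exact ⟨u, hx, hy⟩
  · exact nomatch (show WidePushoutShape.Hom _ _ from fj)
  · exact nomatch (show WidePushoutShape.Hom _ _ from fi)

end Gluing

/-! ### The zero section in the charts of `T*ℙ¹`. -/

instance : IsOpenImmersion chartZero := isOpenImmersion_pushout_inl _ _

instance : IsOpenImmersion chartOne := isOpenImmersion_pushout_inr _ _

/-- The first chart of `T*ℙ¹`. -/
def chartTZero : Spec ringTA ⟶ TP1 := pushout.inl overlapTZero overlapTOne

/-- The second chart of `T*ℙ¹`. -/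
def chartTOne : Spec ringTA ⟶ TP1 := pushout.inr overlapTZero overlapTOne

instance : IsOpenImmersion chartTZero := isOpenImmersion_pushout_inl _ _

instance : IsOpenImmersion chartTOne := isOpenImmersion_pushout_inr _ _

lemma chartZero_zeroSection : chartZero ≫ zeroSection = Spec.map zeroSectionRing ≫ chartTZero :=
  pushout.inl_desc _ _ _

lemma chartOne_zeroSection : chartOne ≫ zeroSection = Spec.map zeroSectionRing ≫ chartTOne :=
  pushout.inr_desc _ _ _

lemma not_mem_of_Spec_map_of_isUnit {R S : CommRingCat.{0}} (φ : R ⟶ S) (a : R)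
    (ha : IsUnit (φ a)) (q : PrimeSpectrum S) : a ∉ (Spec.map φ q : PrimeSpectrum R).asIdeal :=
  fun h => q.isPrime.ne_top (Ideal.eq_top_of_isUnit_mem _ (show φ a ∈ q.asIdeal from h) ha)

lemma isUnit_inclTA_X : IsUnit (inclTA (Polynomial.X : Polynomial (Polynomial ℂ))) := by
  have h : inclTA (Polynomial.X : Polynomial (Polynomial ℂ)) = LaurentPolynomial.T 1 :=
    Polynomial.toLaurent_X
  rw [h]
  exact LaurentPolynomial.isUnit_T 1

lemma zeroSectionRing_X :
    zeroSectionRing (Polynomial.X : Polynomial (Polynomial ℂ)) = (Polynomial.X : Polynomial ℂ) :=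
  Polynomial.map_X _

/-- Up to the automorphism `z ↦ z⁻¹` of the overlap, `overlapOne` is the standard open immersion
with image `D(z)`. -/
lemma mem_range_overlapOne {q : PrimeSpectrum (Polynomial ℂ)} (hq : Polynomial.X ∉ q.asIdeal) :
    ∃ v, overlapOne v = q := by
  have h : Set.range (PrimeSpectrum.comap (Polynomial.toLaurent (R := ℂ))) =
      PrimeSpectrum.basicOpen (Polynomial.X : Polynomial ℂ) :=
    PrimeSpectrum.localization_away_comap_range (LaurentPolynomial ℂ) (Polynomial.X : Polynomial ℂ)
  obtain ⟨v, hv⟩ : q ∈ Set.range (PrimeSpectrum.comap (Polynomial.toLaurent (R := ℂ))) := by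
    rw [h]
    exact hq
  have e : inv (Spec.map flipP1) ≫ overlapOne = Spec.map inclA := by
    rw [overlapOne, Spec.map_comp, IsIso.inv_hom_id_assoc]
  exact ⟨inv (Spec.map flipP1) (show Spec ringG from v), congr($e v).trans hv⟩

/-- If a point `q` of the second chart of `ℙ¹` maps into the first chart of `T*ℙ¹`, its image lies
in the overlap, where the second base coordinate is invertible. That coordinate restricts to the one
of `ℙ¹`, so `q` lies in the overlap of `ℙ¹`. -/
lemma zeroSection_preimage_chartTZero :
    zeroSection ⁻¹ᵁ chartTZero.opensRange ≤ chartZero.opensRange := by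
  rintro p ⟨x, hx⟩
  rcases mem_range_or_mem_range_of_pushout overlapZero overlapOne p with h | ⟨q, rfl⟩
  · exact h
  have hx' : chartTZero x = chartTOne (Spec.map zeroSectionRing q) := by
    have h := congr($chartOne_zeroSection q)
    rw [Scheme.Hom.comp_apply, Scheme.Hom.comp_apply] at h
    exact hx.trans h
  obtain ⟨u, -, hu⟩ := exists_of_pushout_inl_eq_inr overlapTZero overlapTOne hx'
  have hX : (Polynomial.X : Polynomial ℂ) ∉ (q : PrimeSpectrum (Polynomial ℂ)).asIdeal := by
    intro hq
    refine not_mem_of_Spec_map_of_isUnit (inclTA ≫ flipTP1)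
      (Polynomial.X : Polynomial (Polynomial ℂ)) ?_ u ?_
    · rw [CommRingCat.comp_apply]
      exact isUnit_inclTA_X.map flipTP1.hom
    · have h : (Polynomial.X : Polynomial (Polynomial ℂ)) ∈
          (Spec.map zeroSectionRing q : PrimeSpectrum ringTA).asIdeal := by
        change zeroSectionRing (Polynomial.X : Polynomial (Polynomial ℂ)) ∈
          (q : PrimeSpectrum (Polynomial ℂ)).asIdeal
        rw [zeroSectionRing_X]
        exact hq
      rw [← hu] at h
      exact h
  obtain ⟨v, rfl⟩ := mem_range_overlapOne hX
  refine ⟨overlapZero v, ?_⟩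
  have h := congr($overlap_condition v)
  rw [Scheme.Hom.comp_apply, Scheme.Hom.comp_apply] at h
  exact h

/-- The image of the origin satisfies `z = 0`, while `z` is invertible on the overlap. Consequently
the skyscraper has only zero sections inside the second chart. -/
lemma zeroSection_origin_notMem (p : Spec (CommRingCat.of ℂ)) :
    zeroSection (chartZero (originA p)) ∉ chartTOne.opensRange := by
  rintro ⟨y, hy⟩
  have h := congr($chartZero_zeroSection (originA p))
  rw [Scheme.Hom.comp_apply, Scheme.Hom.comp_apply] at h
  obtain ⟨u, hu, -⟩ := exists_of_pushout_inl_eq_inr overlapTZero overlapTOne (h.symm.trans hy.symm)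
  refine not_mem_of_Spec_map_of_isUnit inclTA _ isUnit_inclTA_X u ?_
  have h : (Polynomial.X : Polynomial (Polynomial ℂ)) ∈
      (Spec.map zeroSectionRing (originA p) : PrimeSpectrum ringTA).asIdeal := by
    change Polynomial.evalRingHom (0 : ℂ) (zeroSectionRing
      (Polynomial.X : Polynomial (Polynomial ℂ))) ∈ (p : PrimeSpectrum ℂ).asIdeal
    rw [zeroSectionRing_X]
    simp
  rw [← hu] at h
  exact h

/-! ### Local surjectivity of the evaluation at the origin -/

lemma specSection_surjective_of_field {K : Type} [Field K] (U : (Spec (CommRingCat.of K)).Opens) :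
    Function.Surjective (specSection (CommRingCat.of K) U) := by
  by_cases hU : Nonempty U
  · obtain rfl : U = ⊤ := by
      obtain ⟨x, hx⟩ := hU
      ext y
      exact ⟨fun _ => trivial, fun _ =>
        Subsingleton.elim (α := PrimeSpectrum K) x y ▸ hx⟩
    intro s
    refine ⟨(Scheme.ΓSpecIso (CommRingCat.of K)).hom s, ?_⟩
    have h : (Spec (CommRingCat.of K)).presheaf.map
        (homOfLE (le_top : (⊤ : (Spec (CommRingCat.of K)).Opens) ≤ ⊤)).op = 𝟙 _ :=
      (Spec (CommRingCat.of K)).presheaf.map_id _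
    change (Spec (CommRingCat.of K)).presheaf.map _
      ((Scheme.ΓSpecIso (CommRingCat.of K)).inv _) = s
    rw [h]
    exact congr($((Scheme.ΓSpecIso (CommRingCat.of K)).hom_inv_id) s)
  · obtain rfl : U = ⊥ := by
      ext x
      exact ⟨fun hx => (hU ⟨x, hx⟩).elim, fun hx => hx.elim⟩
    exact fun s => ⟨0, Subsingleton.elim (α := Γ(Spec (CommRingCat.of K), ⊥)) _ _⟩

lemma evalOrigin_app_surjective (U : P1.Opens) : Function.Surjective (evalOrigin.app U) := by
  intro b
  obtain ⟨c, hc⟩ := specSection_surjective_of_field (originA ⁻¹ᵁ chartZero ⁻¹ᵁ U) b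
  refine ⟨specSection ringA (chartZero ⁻¹ᵁ U) (Polynomial.C c : Polynomial ℂ), ?_⟩
  refine (evalOrigin_app U _).trans ((originA_app_specSection _ _).trans ?_)
  rw [← hc, Polynomial.coe_evalRingHom, Polynomial.eval_C]

lemma chartOne_preimage_le {U : P1.Opens} (hU : U ≤ chartZero.opensRange) :
    chartOne ⁻¹ᵁ U ≤ overlapOne.opensRange := by
  intro y hy
  obtain ⟨x, hx⟩ := hU hy
  obtain ⟨u, -, hu⟩ := exists_of_pushout_inl_eq_inr overlapZero overlapOne hx
  exact ⟨u, hu⟩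

/-- Inside the first chart the second chart contributes only its part in the overlap, where
restriction is an isomorphism and `z ^ d` is a unit. So any `s₀` has a matching `s₁`: the line
bundle is trivial there. -/
lemma cechOne_app_surjective (d : ℤ) {U : P1.Opens} (hU : U ≤ chartZero.opensRange) :
    Function.Surjective ((cechOne d).app U) := by
  intro (t : Γ(Spec ringG, overlapZero ⁻¹ᵁ chartZero ⁻¹ᵁ U))
  have : IsIso (overlapOne.app (chartOne ⁻¹ᵁ U)) :=
    overlapOne.isIso_app _ (chartOne_preimage_le hU)
  let ρ : Γ(Spec ringA, chartOne ⁻¹ᵁ U) ⟶ Γ(Spec ringG, overlapZero ⁻¹ᵁ chartZero ⁻¹ᵁ U) :=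
    overlapOne.app (chartOne ⁻¹ᵁ U) ≫
      (Spec ringG).presheaf.map (eqToHom (overlap_preimage U)).op
  have : IsIso ρ := inferInstance
  obtain ⟨r, hr⟩ := (ConcreteCategory.bijective_of_isIso ρ).2
    (t * (Spec ringG).presheaf.map (homOfLE le_top).op (overlapMonomial (-d)))
  refine ⟨r, ?_⟩
  rw [cechOne_app]
  have hr' : (Spec ringG).presheaf.map (eqToHom (overlap_preimage U)).op
      (overlapOne.app (chartOne ⁻¹ᵁ U) r) = _ := hr
  rw [hr', mul_assoc, ← map_mul, overlapMonomial_mul, neg_add_cancel, overlapMonomial_zero,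
    map_one, mul_one]

/-- Lift the value at the origin to a function `s₀` on the first chart, then solve the gluing
equation for `s₁`; the pair is a section of `𝒪(-1)`. -/
lemma lineBundleEval_app_surjective {U : P1.Opens} (hU : U ≤ chartZero.opensRange) :
    Function.Surjective (lineBundleEval.app U) := by
  intro b
  obtain ⟨r, hr⟩ := evalOrigin_app_surjective U b
  obtain ⟨t, ht⟩ := cechOne_app_surjective (-1) hU (cechZero.app U r)
  obtain ⟨a, ha⟩ := exists_app_kernel_ι (cechDifferential (-1)) U
    ((biprod.inl : _ ⟶ (Scheme.Modules.pushforward chartZero).obj (structureModule (Spec ringA)) ⊞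
      (Scheme.Modules.pushforward chartOne).obj (structureModule (Spec ringA))).app U r +
      (biprod.inr : _ ⟶ (Scheme.Modules.pushforward chartZero).obj (structureModule (Spec ringA)) ⊞
      (Scheme.Modules.pushforward chartOne).obj (structureModule (Spec ringA))).app U t) (by
    have h0 := congr(Scheme.Modules.Hom.app
      $(biprod.inl_desc cechZero (-cechOne (-1))) U r)
    have h1 := congr(Scheme.Modules.Hom.app
      $(biprod.inr_desc cechZero (-cechOne (-1))) U t)
    rw [Scheme.Modules.Hom.comp_app, ConcreteCategory.comp_apply] at h0 h1
    rw [cechDifferential_eq, map_add, h0, h1, ← ht]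
    exact add_neg_cancel _)
  refine ⟨a, ?_⟩
  have h0 := congr(Scheme.Modules.Hom.app $(biprod.inl_fst (X :=
    (Scheme.Modules.pushforward chartZero).obj (structureModule (Spec ringA))) (Y :=
    (Scheme.Modules.pushforward chartOne).obj (structureModule (Spec ringA)))) U r)
  have h1 := congr(Scheme.Modules.Hom.app $(biprod.inr_fst (X :=
    (Scheme.Modules.pushforward chartZero).obj (structureModule (Spec ringA))) (Y :=
    (Scheme.Modules.pushforward chartOne).obj (structureModule (Spec ringA)))) U t)
  rw [Scheme.Modules.Hom.comp_app, ConcreteCategory.comp_apply] at h0 h1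
  change evalOrigin.app U (Scheme.Modules.Hom.app (biprod.fst :
    (Scheme.Modules.pushforward chartZero).obj (structureModule (Spec ringA)) ⊞
      (Scheme.Modules.pushforward chartOne).obj (structureModule (Spec ringA)) ⟶ _) U ((kernel.ι (cechDifferential (-1))).app U a)) = b
  rw [ha, map_add, h0, h1, map_add]
  refine Eq.trans ?_ hr
  exact (congr(_ + $(map_zero (evalOrigin.app U).hom))).trans (add_zero _)

/-- Near a point of the first chart of `T*ℙ¹`, the relevant part of `ℙ¹` lies in its first chart,
where evaluation is surjective on sections. Inside the second chart the target has only the zero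
section, so `0` is a preimage. -/
lemma epi_pushforward_lineBundleEval :
    Epi ((Scheme.Modules.pushforward zeroSection).map lineBundleEval) := by
  refine epi_of_locally_surjective _ fun U b x hx => ?_
  rcases mem_range_or_mem_range_of_pushout overlapTZero overlapTOne x with h | h
  · obtain ⟨a, ha⟩ := lineBundleEval_app_surjective (U := zeroSection ⁻¹ᵁ
        (U ⊓ chartTZero.opensRange))
      (fun p hp => zeroSection_preimage_chartTZero hp.2)
      (((Scheme.Modules.pushforward zeroSection).obj
        ((Scheme.Modules.pushforward (originA ≫ chartZero)).obj
          (structureModule (Spec (CommRingCat.of ℂ))))).presheaf.map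
            (homOfLE (inf_le_left : U ⊓ chartTZero.opensRange ≤ U)).op b)
    exact ⟨U ⊓ chartTZero.opensRange, inf_le_left, a, ⟨hx, h⟩, ha⟩
  · refine ⟨U ⊓ chartTOne.opensRange, inf_le_left, 0, ⟨hx, h⟩, ?_⟩
    have hbot : originA ⁻¹ᵁ chartZero ⁻¹ᵁ zeroSection ⁻¹ᵁ (U ⊓ chartTOne.opensRange) = ⊥ := by
      ext p
      exact ⟨fun hp => (zeroSection_origin_notMem p hp.2).elim, fun hp => hp.elim⟩
    have : Subsingleton Γ(Spec (CommRingCat.of ℂ), originA ⁻¹ᵁ chartZero ⁻¹ᵁ zeroSection ⁻¹ᵁ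
        (U ⊓ chartTOne.opensRange)) := by
      rw [hbot]
      infer_instance
    exact Subsingleton.elim (α := Γ(Spec (CommRingCat.of ℂ), originA ⁻¹ᵁ chartZero ⁻¹ᵁ
      zeroSection ⁻¹ᵁ (U ⊓ chartTOne.opensRange))) _ _

lemma shortExact_comp_iso {A : Type u} [Category.{v} A] [Abelian A] {S : ShortComplex A}
    (hS : S.ShortExact) {B : A} (j : S.X₃ ≅ B) :
    ∃ w, (ShortComplex.mk S.f (S.g ≫ j.hom) w).ShortExact :=
  ⟨by rw [S.zero_assoc, zero_comp], ShortComplex.shortExact_of_iso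
    (ShortComplex.isoMk (S₁ := S) (Iso.refl _) (Iso.refl _) j (by simp) (by simp)) hS⟩

/-- The sequence `0 ⟶ i_* 𝒪(-2) ⟶ i_* 𝒪(-1) ⟶ i_* 𝒪_y ⟶ 0` for the origin `y`. -/
lemma exists_shortExact_iLineBundle :
    ∃ (f : iLineBundle (-2) ⟶ iLineBundle (-1)) (g : iLineBundle (-1) ⟶ iSkyscraper (some 0))
      (w : f ≫ g = 0), (ShortComplex.mk f g w).ShortExact := by
  obtain ⟨w, ⟨h⟩⟩ := exact_lineBundleMap
  let F := Scheme.Modules.pushforward zeroSection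
  let S := ShortComplex.mk _ _ w
  have hS : (S.map F).Exact ∧ Mono (S.map F).f :=
    (S.map F).exact_and_mono_f_iff_f_is_kernel.mpr ⟨KernelFork.mapIsLimit _ h F⟩
  have : Epi (S.map F).g := epi_pushforward_lineBundleEval
  have : Mono (S.map F).f := hS.2
  have hS' : (S.map F).ShortExact := ⟨hS.1⟩
  let j : (S.map F).X₃ ≅ iSkyscraper (some 0) :=
    (Scheme.Modules.pushforwardComp (originA ≫ chartZero) zeroSection).app _
  exact ⟨_, _, shortExact_comp_iso hS' j⟩

/-! ### The triangle of the simple objects -/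

section SimpleTriangle

variable {C : Type u} [Category.{v} C] [HasZeroObject C] [HasShift C ℤ] [Preadditive C]
  [∀ n : ℤ, (shiftFunctor C n).Additive] [Pretriangulated C] {D : ObjectProperty C}

/-- Rotating makes `B ⟶ O ⟶ A[1]` distinguished, so only the shift `A[1]` needs to be represented in
`D` and `A` itself does not occur. The sign in the last map comes from the rotation. -/
lemma classK_add_of_distTriang_of_iso {A B O : C} {f : A ⟶ B} {g : B ⟶ O} {h : O ⟶ A⟦(1 : ℤ)⟧}
    (hT : Triangle.mk f g h ∈ distTriang C) (S T Y : D.FullSubcategory)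
    (eS : S.obj ≅ B) (eT : T.obj ≅ A⟦(1 : ℤ)⟧) (eY : Y.obj ≅ O) :
    classK Y = classK S + classK T := by
  refine classK_of_distTriang S Y T (eS.hom ≫ g ≫ eY.inv) (eY.hom ≫ h ≫ eT.inv)
    (eT.hom ≫ (-f⟦(1 : ℤ)⟧') ≫ eS.inv⟦(1 : ℤ)⟧') ?_
  refine isomorphic_distinguished _ (rot_of_distTriang _ hT) _
    (Triangle.isoMk _ _ eS eY eT ?_ ?_ ?_)
  · change (eS.hom ≫ g ≫ eY.inv) ≫ eY.hom = eS.hom ≫ g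
    simp
  · change (eY.hom ≫ h ≫ eT.inv) ≫ eT.hom = eY.hom ≫ h
    simp
  · change (eT.hom ≫ (-f⟦(1 : ℤ)⟧') ≫ eS.inv⟦(1 : ℤ)⟧') ≫ eS.hom⟦(1 : ℤ)⟧' =
      eT.hom ≫ (-f⟦(1 : ℤ)⟧')
    rw [Category.assoc, Category.assoc, ← Functor.map_comp, eS.inv_hom_id,
      CategoryTheory.Functor.map_id,
      Category.comp_id]

end SimpleTriangle

lemma not_isZero_of_faithful {A C : Type*} [Category* A] [HasZeroMorphisms A] [Category* C]
    {D : ObjectProperty C} (ι : A ⥤ D.FullSubcategory) [ι.Faithful] {X : A} (hX : 𝟙 X ≠ 0) :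
    ¬ IsZero (ι.obj X).obj := fun h => hX <| ι.map_injective <|
  ObjectProperty.hom_ext _ (h.eq_of_src _ _)

end

/-! ### The charges of the simple objects and the mirror map. -/

theorem proposition6p3
    [HasDerivedCategory.{w} TP1.Modules]
    (x ϖ : ℂ) (hϖ : IsVarpiOne x ϖ)
    (σ : BridgelandStability (dbP1.{w})) (θ : ℝ)
    (ι : NilRepK ⥤ (dbP1.{w}).FullSubcategory) [ι.Full] [ι.Faithful]
    (hheart : ∀ E : (dbP1.{w}).FullSubcategory, ι.essImage E ↔ σ.heart θ E.obj)
    (hzero : Nonempty ((ι.obj NilRepK.simpleZero).obj ≅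
      (DerivedCategory.singleFunctor TP1.Modules 0).obj (iLineBundle (-1))))
    (hone : Nonempty ((ι.obj NilRepK.simpleOne).obj ≅
      ((DerivedCategory.singleFunctor TP1.Modules 0).obj (iLineBundle (-2)))⟦(1 : ℤ)⟧))
    (O : OnePoint ℂ → (dbP1.{w}).FullSubcategory)
    (hO : ∀ y, Nonempty ((O y).obj ≅
      (DerivedCategory.singleFunctor TP1.Modules 0).obj (iSkyscraper y)))
    (hZpoint : ∀ y, σ.Z (classK (O y)) = varpiZero x)
    (hZline : σ.Z (classK (ι.obj NilRepK.simpleZero)) = ϖ) :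
    ϖ ≠ 0 ∧
    (Simple NilRepK.simpleZero ∧ Simple NilRepK.simpleOne ∧
      IsEmpty (NilRepK.simpleZero ≅ NilRepK.simpleOne) ∧
      ∀ S : NilRepK, Simple S →
        Nonempty (S ≅ NilRepK.simpleZero) ∨ Nonempty (S ≅ NilRepK.simpleOne)) ∧
    ∀ c : ℂ, Complex.exp c = ϖ →
      (∀ E : GrothendieckK (dbP1.{w}), (σ.dilateRotate c).Z E = ϖ * σ.Z E) ∧
      (∀ E : (dbP1.{w}).FullSubcategory,
        ι.essImage E ↔ (σ.dilateRotate c).heart (θ + c.im / Real.pi) E.obj) ∧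
      (σ.dilateRotate c).Z (classK (ι.obj NilRepK.simpleZero)) +
        (σ.dilateRotate c).Z (classK (ι.obj NilRepK.simpleOne)) = ϖ ∧
      Complex.exp (2 * Real.pi * Complex.I *
        ((σ.dilateRotate c).Z (classK (ι.obj NilRepK.simpleZero)) +
          (σ.dilateRotate c).Z (classK (ι.obj NilRepK.simpleOne)))) = mirrorMap ϖ := by
  -- The class of the skyscraper at the origin splits as `[S₀] + [S₁]`, and its charge is `ϖ₀ = 1`.
  have hsum : σ.Z (classK (ι.obj NilRepK.simpleZero)) +
      σ.Z (classK (ι.obj NilRepK.simpleOne)) = 1 := by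
    obtain ⟨f, g, w, hS⟩ := exists_shortExact_iLineBundle
    have h := classK_add_of_distTriang_of_iso hS.singleTriangle_distinguished
      (ι.obj NilRepK.simpleZero) (ι.obj NilRepK.simpleOne) (O (some 0))
      hzero.some hone.some (hO (some 0)).some
    rw [← map_add, ← h]
    exact hZpoint _
  have hϖ0 : ϖ ≠ 0 := by
    rw [← hZline]
    -- The object `S₀` lies in the heart and is nonzero because its identity survives the faithful
    -- functor `ι`.
    exact σ.charge_ne_zero_of_heart _ ((hheart _).mp (ι.obj_mem_essImage _))
      (not_isZero_of_faithful ι NilRepK.id_simpleZero_ne_zero)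
  refine ⟨hϖ0, ⟨NilRepK.simple_simpleZero, NilRepK.simple_simpleOne,
    NilRepK.isEmpty_simpleZero_iso_simpleOne, NilRepK.iso_simple_of_simple⟩, fun c hc => ?_⟩
  have hZ (E : GrothendieckK dbP1.{w}) : (σ.dilateRotate c).Z E = ϖ * σ.Z E := by
    rw [← hc]
    rfl
  have hZsum : (σ.dilateRotate c).Z (classK (ι.obj NilRepK.simpleZero)) +
      (σ.dilateRotate c).Z (classK (ι.obj NilRepK.simpleOne)) = ϖ := by
    rw [hZ, hZ, ← mul_add, hsum, mul_one]
  exact ⟨hZ, fun E => (hheart E).trans (σ.dilateRotate_heart_iff c θ E.obj).symm, hZsum,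
    by rw [hZsum, mirrorMap]⟩
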